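/- **Notions.** Let $\Sigma=\{0,\dots,\sigma-1\}$ be an alphabet of size $\sigma$ and $P=P[0]\cdots P[m-1]\in\Sigma^m$ with $m\ge 1$. *Swap automaton.* $\mathcal A_\pi(P)$ is the nondeterministic automaton with states $q_0,\dots,q_{2m-1}$, initial state $q_0$, final state $q_m$ and the transitions $q_0\to q_0$ on every symbol; $q_i\to q_{i+1}$ on $P[i]$ for $0\le i<m$; $q_i\to q_{i+m+1}$ on $P[i+1]$ for $0\le i<m-1$; $q_i\to q_{i-m+1}$ on $P[i-m-1]$ for $m+1\le i<2m$. (For those $i$ with $P[i]=P[i+1]$ one may either keep or omit the transition $q_i\to q_{i+m+1}$; the theorem holds for both conventions.) Let $\delta^*(q_0,S)$ be the set of states reached on the input $S$. *The number $k$.* For a string $S$ let $\phi(S)$ arise from $S$ by exchanging the symbols at positions $2i$ and $2i+1$ for all $i$ with $2i+1<|S|$. Let $P_o=\phi(P)$ and $P_e=P[0]\,\phi(P[1\ldots m-1])$. For $s<|S|$ let $\ell(S,s)$ be the greatest $i\le |S|-s$ such that the symbols $S[s],\dots,S[s+i-1]$ are pairwise distinct. Put $r_0=0$ and $r_{j+1}=r_j+\min\{\ell(P,r_j),\ell(P_e,r_j),\ell(P_o,r_j)\}$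 as long as $r_j<m$, and let $k$ be the index with $r_k=m$. In other words, $k$ is the common number of factors of the factorizations in the 1-collection of $P,P_e,P_o$, which cuts the three strings greedily, at the same positions, into factors without repeated symbols. *Machine.* A random access machine with $s$ memory cells and $R$ word registers, each holding a word of $w$ bits, and $R$ index registers holding integers between $0$ and $\max(s,w)$. At unit cost it can load a constant, perform a bitwise and, or, not or shift on word registers, add, subtract (truncated at 0) and multiply index registers, load or store a memory cell addressed by an index register, compare two index registers, and test whether a word register is zero. Programs are built from these instructions by sequencing, conditionals and while loops; an index or address out of range is not allowed. A text is read symbol by symbol: each symbol is put into a fixed index register at unit cost, and then the program is run. The space is $s+2R$. **Theorem.** There are a number $R$, a program with $R$ word and $R$ index registers, and a constant $C$, such that for all $\sigma$, all word sizes $w\ge1$ and all $P\in\Sigma^m$ with $m\ge1$, the number $k$ defined above satisfies $$\lceil m/\sigma\rceil\le k\le m,$$ and $\mathcal A_\pi(P)$ can be encoded in $O(\sigma^2\lceil k/w\rceil)$ space and simulated on a string of length $n$ in $O(n\lceil k/w\rceil)$ time. That is, there is an initial content of the registers and of $s$ memory cells, with $$s+2R\le C\,\sigma^2\lceil k/w\rceil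 ,$$ such that on every text $T\in\Sigma^*$ of length $n$ the machine, started with this content, halts after at most $C\,n\,\lceil k/w\rceil$ steps in a situation that represents $\delta^*(q_0,T)$ in the following sense. 1. For every state $q$ there is a set of at most $C$ pairs (symbol, bit position in memory), which does not depend on $T$, such that for $q\neq q_0$ the state $q$ belongs to $\delta^*(q_0,T)$ if and only if $T$ is nonempty and one of these pairs $(a,\beta)$ has $a$ equal to the last symbol of $T$ and the bit at position $\beta$ set. (The state $q_0$ always belongs to $\delta^*(q_0,T)$.) 2. A fixed index register holds $1$ if and only if $\mathcal A_\pi(P)$ accepts $T$. -/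

import Mathlib

/-! ## Strings, the swap automaton, the 1-collection -/

/-- `φ(S)`: exchange the symbols at positions `0,1`, at positions `2,3`, and so on; if `|S|` is odd,
the last symbol stays in place. -/
def pairSwap {α : Type*} : List α → List α
  | a :: b :: l => b :: a :: pairSwap l
  | l => l

/-- `P_o = φ(P)`. -/
def oddString {α : Type*} (P : List α) : List α := pairSwap P

/-- `P_e = P[0] φ(P[1 .. m-1])`. -/
def evenString {α : Type*} : List α → List α
  | [] => []
  | a :: l => a :: pairSwap l

/-- `1-len(S, s)`: the greatest `i ≤ |S| - s` such that the symbols of `S[s .. s+i-1]` are pairwise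
distinct. (So `s + i = |S|`, or `S[s+i]` occurs in `S[s .. s+i-1]`.) -/
def oneLen {α : Type*} [DecidableEq α] (S : List α) (s : ℕ) : ℕ :=
  Nat.findGreatest (fun i => ((S.drop s).take i).Nodup) (S.length - s)

/-- The starting position of the `(j+1)`-st factor in the 1-collection of `P`, `P_e`, `P_o`: every
factor has the smallest of the three lengths `1-len` at the position where it starts. -/
def collectionStart {α : Type*} [DecidableEq α] (P : List α) : ℕ → ℕ
  | 0 => 0
  | j + 1 => collectionStart P j +
      min (oneLen P (collectionStart P j))
        (min (oneLen (evenString P) (collectionStart P j))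
          (oneLen (oddString P) (collectionStart P j)))

/-- The common number `k` of factors of the three factorizations in the 1-collection of
`P`, `P_e`, `P_o`: the number of factors that it takes to reach the end of the string. -/
noncomputable def collectionSize {α : Type*} [DecidableEq α] (P : List α) : ℕ :=
  sInf {j | P.length ≤ collectionStart P j}

/-- The swap automaton `A_π(P)` with states `q_0, …, q_{2m-1}`, `m = |P|`.

The clauses of the transition function for `c = P[i]` and `c = P[i+1]` overlap when
`P[i] = P[i+1]`. With `both = true` all the applicable clauses contribute transitions; with
`both = false` the first one, that for `c = P[i]`, takes precedence. -/
def swapNFA {α : Type*} (both : Bool) (P : List α) : NFA α (Fin (2 * P.length)) where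
  step q c := {q' |
    ((q : ℕ) = 0 ∧ (q' : ℕ) = 0) ∨
    ((q : ℕ) < P.length ∧ P[(q : ℕ)]? = some c ∧ (q' : ℕ) = q + 1) ∨
    ((q : ℕ) + 1 < P.length ∧ P[(q : ℕ) + 1]? = some c ∧ (both = true ∨ P[(q : ℕ)]? ≠ some c) ∧
      (q' : ℕ) = q + P.length + 1) ∨
    (P.length + 1 ≤ (q : ℕ) ∧ P[(q : ℕ) - P.length - 1]? = some c ∧
      (q' : ℕ) = q - P.length + 1)}
  start := {q | (q : ℕ) = 0}
  accept := {q | (q : ℕ) = P.length}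

/-! ## A random access machine with `w`-bit words

The machine has `s` memory cells, each holding a word of `w` bits, and `R` word registers. For the
addressing it has `R` index registers, which hold numbers `≤ max s w` (memory addresses, lengths of
arrays, bit positions). -/

structure RamState (w s R : ℕ) where
  idx : Fin R → ℕ
  wd : Fin R → BitVec w
  mem : Fin s → BitVec w

namespace RamState

variable {w s R : ℕ}

/-- All index registers hold numbers in the permitted range. -/
def Valid (st : RamState w s R) : Prop := ∀ r, st.idx r ≤ max s w

/-- Write `v` to an index register; undefined if `v` is out of range. -/
def setIdx (st : RamState w s R) (d : Fin R) (v : ℕ) : Option (RamState w s R) :=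
  if v ≤ max s w then some { st with idx := Function.update st.idx d v } else none

/-- Write `x` to a word register. -/
def setWd (st : RamState w s R) (d : Fin R) (x : BitVec w) : RamState w s R :=
  { st with wd := Function.update st.wd d x }

end RamState

/-- The elementary instructions; `d` is the destination. -/
inductive RamInstr (R : ℕ) where
  /-- index register `d` := the constant `n` -/
  | iconst (d : Fin R) (n : ℕ)
  | iadd (d a b : Fin R)
  /-- truncated subtraction -/
  | isub (d a b : Fin R)
  | imul (d a b : Fin R)
  /-- word register `d` := the constant `n` (modulo `2 ^ w`) -/
  | wconst (d : Fin R) (n : ℕ)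
  | and (d a b : Fin R)
  | or (d a b : Fin R)
  | not (d a : Fin R)
  /-- word register `d` := word register `a` shifted by the content of index register `b` -/
  | shl (d a b : Fin R)
  | shr (d a b : Fin R)
  /-- word register `d` := the memory cell addressed by index register `a` -/
  | load (d a : Fin R)
  /-- the memory cell addressed by index register `a` := word register `b` -/
  | store (a b : Fin R)

/-- Effect of an instruction; `none` if an index or an address is out of range. -/
def RamInstr.exec {w s R : ℕ} : RamInstr R → RamState w s R → Option (RamState w s R)
  | iconst d n, st => st.setIdx d n
  | iadd d a b, st => st.setIdx d (st.idx a + st.idx b)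
  | isub d a b, st => st.setIdx d (st.idx a - st.idx b)
  | imul d a b, st => st.setIdx d (st.idx a * st.idx b)
  | wconst d n, st => some (st.setWd d (BitVec.ofNat w n))
  | and d a b, st => some (st.setWd d (st.wd a &&& st.wd b))
  | or d a b, st => some (st.setWd d (st.wd a ||| st.wd b))
  | not d a, st => some (st.setWd d (~~~ st.wd a))
  | shl d a b, st => some (st.setWd d (st.wd a <<< st.idx b))
  | shr d a b, st => some (st.setWd d (st.wd a >>> st.idx b))
  | load d a, st => if h : st.idx a < s then some (st.setWd d (st.mem ⟨st.idx a, h⟩)) else none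
  | store a b, st =>
      if h : st.idx a < s then
        some { st with mem := Function.update st.mem ⟨st.idx a, h⟩ (st.wd b) }
      else none

/-- Programs over `R` word registers and `R` index registers. -/
inductive RamProg (R : ℕ) where
  | instr (i : RamInstr R)
  | seq (p q : RamProg R)
  /-- if index register `a` < index register `b` then `p` else `q` -/
  | ifLt (a b : Fin R) (p q : RamProg R)
  /-- if word register `a` is nonzero then `p` else `q` -/
  | ifNonzero (a : Fin R) (p q : RamProg R)
  /-- while index register `a` < index register `b` do `p` -/
  | whileLt (a b : Fin R) (p : RamProg R)

/-- `RamRun p st t st₁`: started in `st`, the program `p` halts in `st₁` after exactly `t` steps.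
Every instruction and every evaluation of a test is one step. -/
inductive RamRun {w s R : ℕ} : RamProg R → RamState w s R → ℕ → RamState w s R → Prop
  | instr {i : RamInstr R} {st st₁ : RamState w s R} (h : i.exec st = some st₁) :
      RamRun (.instr i) st 1 st₁
  | seq {p q : RamProg R} {st st₁ st₂ : RamState w s R} {t t₁ : ℕ}
      (hp : RamRun p st t st₁) (hq : RamRun q st₁ t₁ st₂) :
      RamRun (.seq p q) st (t + t₁) st₂
  | ifLt_true {a b : Fin R} {p q : RamProg R} {st st₁ : RamState w s R} {t : ℕ}
      (h : st.idx a < st.idx b) (hp : RamRun p st t st₁) :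
      RamRun (.ifLt a b p q) st (t + 1) st₁
  | ifLt_false {a b : Fin R} {p q : RamProg R} {st st₁ : RamState w s R} {t : ℕ}
      (h : ¬ st.idx a < st.idx b) (hq : RamRun q st t st₁) :
      RamRun (.ifLt a b p q) st (t + 1) st₁
  | ifNonzero_true {a : Fin R} {p q : RamProg R} {st st₁ : RamState w s R} {t : ℕ}
      (h : st.wd a ≠ 0) (hp : RamRun p st t st₁) :
      RamRun (.ifNonzero a p q) st (t + 1) st₁
  | ifNonzero_false {a : Fin R} {p q : RamProg R} {st st₁ : RamState w s R} {t : ℕ}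
      (h : st.wd a = 0) (hq : RamRun q st t st₁) :
      RamRun (.ifNonzero a p q) st (t + 1) st₁
  | whileLt_true {a b : Fin R} {p : RamProg R} {st st₁ st₂ : RamState w s R} {t t₁ : ℕ}
      (h : st.idx a < st.idx b) (hp : RamRun p st t st₁)
      (hw : RamRun (.whileLt a b p) st₁ t₁ st₂) :
      RamRun (.whileLt a b p) st (t + t₁ + 1) st₂
  | whileLt_false {a b : Fin R} {p : RamProg R} {st : RamState w s R}
      (h : ¬ st.idx a < st.idx b) :
      RamRun (.whileLt a b p) st 1 st

/-- `RamReads p inp st T t st₁`: started in `st`, the machine reads the text `T` symbol by symbol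
and halts in `st₁` after exactly `t` steps. For every symbol of the text it puts the symbol into the
index register `inp` (one step) and runs `p`. -/
inductive RamReads {σ w s R : ℕ} (p : RamProg R) (inp : Fin R) :
    RamState w s R → List (Fin σ) → ℕ → RamState w s R → Prop
  | nil (st : RamState w s R) : RamReads p inp st [] 0 st
  | cons {c : Fin σ} {T : List (Fin σ)} {st st₁ st₂ st₃ : RamState w s R} {t t₁ : ℕ}
      (hc : st.setIdx inp c = some st₁) (hp : RamRun p st₁ t st₂)
      (hT : RamReads p inp st₂ T t₁ st₃) :
      RamReads p inp st (c :: T) (1 + t + t₁) st₃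

/-- Bit vectors in memory represent a set `D` of states of an automaton, relative to the last symbol
`a` read: the state `q` belongs to `D` iff one of the pairs `(a, (i, b))` with `(i, b)` the position
of a set bit (bit `b` of cell `i`) belongs to `probe q`. -/
def BitEncodes {σ w s N : ℕ} (probe : Fin N → Finset (Fin σ × Fin s × Fin w))
    (mem : Fin s → BitVec w) (last : Option (Fin σ)) (q : Fin N) : Prop :=
  ∃ x ∈ probe q, last = some x.1 ∧ (mem x.2.1).getLsbD x.2.2 = true

/-! ## The factorization -/

section Factorization

variable {α : Type*} [DecidableEq α]

/-! Every transition except the loop at `q_0` is attached to a position of one of three strings, the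
lanes: `q_i → q_{i+1}` to position `i` of `P`, and the two transitions of a swap of positions `i`,
`i+1` to these positions of `P_o` (`i` even) or `P_e` (`i` odd). There the symbols of the string are
exactly the labels. A position of a lane carries at most one transition, and the symbols within a
factor are distinct; so a lane, a factor and a symbol determine at most one transition
(`FactorStep.unique`).

Hence, once the last symbol is known, three vectors of `k` bits describe the reached set: bit `j` of
lane `S` says whether the transition on that symbol in factor `j` of lane `S` has just been taken
(`LaneBit`). Conversely, a target state fixes factor and label in each lane
(`FactorStep.factor_label_unique`), so at most three bits need to be probed for a state.

Consecutive transitions sit at consecutive positions, hence in the same factor or in adjacent ones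
(`FactorStep.factor_eq_or_succ`). When `c` follows `a`, a new bit `j` is therefore set because its
transition leaves `q_0`, or because of an old bit `j` or `j-1`. So each new vector is a disjunction
of seven operands (all ones, three old vectors, three shifted ones), masked by vectors that depend
only on `(a, c)` (`laneBit_append_singleton`). With three target lanes and three masks for
acceptance, this makes 24 masks for each of the `σ²` pairs, and one pass with constant work per
word.

The bounds on `k` hold because a factor has at least one and at most `σ` symbols. The rest is
verification of the program: weakest preconditions for straight-line code (`wp_bodyCode`) and a loop
invariant (`LoopInv.step`). -/

theorem nodup_take_drop_oneLen (S : List α) (s : ℕ) : ((S.drop s).take (oneLen S s)).Nodup :=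
  Nat.findGreatest_spec (P := fun i => ((S.drop s).take i).Nodup) (Nat.zero_le _) (by simp)

theorem oneLen_le (S : List α) (s : ℕ) : oneLen S s ≤ S.length - s :=
  Nat.findGreatest_le _

theorem oneLen_pos {S : List α} {s : ℕ} (h : s < S.length) : 0 < oneLen S s := by
  refine Nat.le_findGreatest (P := fun i => ((S.drop s).take i).Nodup) (by omega) ?_
  cases S.drop s <;> simp

theorem oneLen_le_card [Fintype α] (S : List α) (s : ℕ) : oneLen S s ≤ Fintype.card α := by
  have h := (nodup_take_drop_oneLen S s).length_le_card
  have := oneLen_le S s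
  simp only [List.length_take, List.length_drop] at h
  omega

theorem eq_of_getElem?_eq_of_oneLen {S : List α} {s n i i' : ℕ} {c : α} (hn : n ≤ oneLen S s)
    (hi : s ≤ i) (hi' : s ≤ i') (hin : i < s + n) (hin' : i' < s + n)
    (h : S[i]? = some c) (h' : S[i']? = some c) : i = i' := by
  have hd := nodup_take_drop_oneLen S s
  have e : ∀ x, s ≤ x → x < s + n → ((S.drop s).take (oneLen S s))[x - s]? = S[x]? := by
    intro x h1 h2
    rw [List.getElem?_take, if_pos (by omega), List.getElem?_drop]
    congr 1
    omega
  have h1 := (e i hi hin).trans h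
  have h2 := (e i' hi' hin').trans h'
  have hlt : i - s < ((S.drop s).take (oneLen S s)).length := by
    by_contra hc
    rw [List.getElem?_eq_none (by omega)] at h1
    cases h1
  have := (List.getElem?_inj hlt hd).1 (h1.trans h2.symm)
  omega

/-! ### The exchanged strings, position by position. -/

theorem length_pairSwap {β : Type*} (l : List β) : (pairSwap l).length = l.length := by
  induction l using pairSwap.induct with
  | case1 a b l ih => simp [pairSwap, ih]
  | case2 l h => 
    cases l with
    | nil => rfl
    | cons a l => 
      cases l with
      | nil => rfl
      | cons b l => exact absurd rfl (h a b l)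

theorem getElem?_pairSwap_even {β : Type*} (l : List β) (i : ℕ) (hi : i % 2 = 0)
    (h : i + 1 < l.length) : (pairSwap l)[i]? = l[i + 1]? := by
  induction l using pairSwap.induct generalizing i with
  | case1 a b l ih =>
    match i with
    | 0 => simp [pairSwap]
    | 1 => omega
    | i + 2 =>
      simp only [List.length_cons] at h
      simpa [pairSwap] using ih i (by omega) (by omega)
  | case2 l hl =>
    match l, hl with
    | [], _ => simp at h
    | [a], _ => simp at h
    | a :: b :: l, hl => exact absurd rfl (hl a b l)

theorem getElem?_pairSwap_odd {β : Type*} (l : List β) (i : ℕ) (hi : i % 2 = 1)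
    (h : i < l.length) : (pairSwap l)[i]? = l[i - 1]? := by
  induction l using pairSwap.induct generalizing i with
  | case1 a b l ih =>
    match i with
    | 0 => omega
    | 1 => simp [pairSwap]
    | i + 2 =>
      simp only [List.length_cons] at h
      have := ih i (by omega) (by omega)
      rw [show i + 2 - 1 = (i - 1) + 2 by omega]
      simpa [pairSwap] using this
  | case2 l hl =>
    match l, hl with
    | [], _ => simp at h
    | [a], _ => simp at h; omega
    | a :: b :: l, hl => exact absurd rfl (hl a b l)

theorem length_oddString {β : Type*} (P : List β) : (oddString P).length = P.length :=
  length_pairSwap P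

theorem length_evenString {β : Type*} (P : List β) : (evenString P).length = P.length := by
  cases P with
  | nil => rfl
  | cons a l => simp [evenString, length_pairSwap]

theorem getElem?_evenString_odd {β : Type*} (P : List β) (i : ℕ) (hi : i % 2 = 1)
    (h : i + 1 < P.length) : (evenString P)[i]? = P[i + 1]? := by
  match P, i with
  | [], _ => simp at h
  | _, 0 => omega
  | a :: l, i + 1 =>
    simp only [List.length_cons] at h
    simpa [evenString] using getElem?_pairSwap_even l i (by omega) (by omega)

theorem getElem?_evenString_even {β : Type*} (P : List β) (i : ℕ) (hi : i % 2 = 0)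
    (hpos : 0 < i) (h : i < P.length) : (evenString P)[i]? = P[i - 1]? := by
  match P, i with
  | [], _ => simp at h
  | _, 0 => omega
  | a :: l, i + 1 =>
    simp only [List.length_cons] at h
    have := getElem?_pairSwap_odd l i (by omega) (by omega)
    rw [show i + 1 - 1 = (i - 1) + 1 by omega]
    simpa [evenString] using this

/-- The three strings of the 1-collection. -/
def laneString (P : List α) : Fin 3 → List α
  | 0 => P
  | 1 => oddString P
  | 2 => evenString P

/-! ### Growth of the cut positions and the range of `k`. -/

theorem collectionStart_succ_le_oneLen (P : List α) (j : ℕ) (S : Fin 3) :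
    collectionStart P (j + 1) - collectionStart P j
      ≤ oneLen (laneString P S) (collectionStart P j) := by
  fin_cases S <;> simp [collectionStart, laneString]

theorem collectionStart_le_succ (P : List α) (j : ℕ) :
    collectionStart P j ≤ collectionStart P (j + 1) := by
  simp [collectionStart]

theorem collectionStart_lt_succ {P : List α} {j : ℕ} (h : collectionStart P j < P.length) :
    collectionStart P j < collectionStart P (j + 1) := by
  have h1 := oneLen_pos h
  have h2 := oneLen_pos (h.trans_eq (length_evenString P).symm)
  have h3 := oneLen_pos (h.trans_eq (length_oddString P).symm)
  simp only [collectionStart]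
  omega

/-- Before the end every factor is nonempty; from the end on it is enough that the cut positions do
not decrease, as `j ≤ |P|`. -/
theorem le_collectionStart_of_le (P : List α) (j : ℕ) (h : j ≤ P.length) :
    j ≤ collectionStart P j := by
  induction j with
  | zero => simp
  | succ j ih =>
    have := ih (by omega)
    have := collectionStart_le_succ P j
    by_cases hlt : collectionStart P j < P.length
    · have := collectionStart_lt_succ hlt
      omega
    · omega

theorem collectionStart_le_mul_card [Fintype α] (P : List α) (j : ℕ) :
    collectionStart P j ≤ j * Fintype.card α := by
  induction j with
  | zero => simp [collectionStart]
  | succ j ih =>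
    have := oneLen_le_card P (collectionStart P j)
    simp only [collectionStart, Nat.succ_mul]
    omega

theorem length_le_collectionStart_collectionSize (P : List α) :
    P.length ≤ collectionStart P (collectionSize P) :=
  Nat.sInf_mem (s := {j | P.length ≤ collectionStart P j})
    ⟨P.length, le_collectionStart_of_le P _ le_rfl⟩

theorem collectionSize_le_length (P : List α) : collectionSize P ≤ P.length :=
  Nat.sInf_le (le_collectionStart_of_le P _ le_rfl)

theorem length_le_collectionSize_mul_card [Fintype α] (P : List α) :
    P.length ≤ collectionSize P * Fintype.card α :=
  (length_le_collectionStart_collectionSize P).trans (collectionStart_le_mul_card P _)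

theorem collectionSize_pos {P : List α} (hP : P ≠ []) : 0 < collectionSize P := by
  rw [Nat.pos_iff_ne_zero]
  intro h
  have := length_le_collectionStart_collectionSize P
  rw [h] at this
  simp [collectionStart] at this
  exact hP this

/-- The index of the factor that contains position `i`. -/
noncomputable def factorIndex (P : List α) (i : ℕ) : ℕ :=
  sInf {j | i < collectionStart P (j + 1)}

theorem lt_collectionStart_factorIndex_succ {P : List α} {i : ℕ} (h : i < P.length) :
    i < collectionStart P (factorIndex P i + 1) :=
  Nat.sInf_mem (s := {j | i < collectionStart P (j + 1)})
    ⟨P.length, h.trans_le ((le_collectionStart_of_le P _ le_rfl).trans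
      (collectionStart_le_succ P _))⟩

theorem factorIndex_le_of_lt {P : List α} {i j : ℕ} (h : i < collectionStart P (j + 1)) :
    factorIndex P i ≤ j :=
  Nat.sInf_le h

/-- By minimality of the index. Positions past the end are harmless: there the infimum of the empty
set is `0`, and factor `0` starts at `0`. -/
theorem collectionStart_factorIndex_le (P : List α) (i : ℕ) :
    collectionStart P (factorIndex P i) ≤ i := by
  rcases h : factorIndex P i with _ | j
  · simp [collectionStart]
  · by_contra hc
    have := factorIndex_le_of_lt (not_le.1 hc)
    omega

theorem factorIndex_lt_collectionSize {P : List α} {i : ℕ} (h : i < P.length) :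
    factorIndex P i < collectionSize P := by
  have hpos := collectionSize_pos (List.ne_nil_of_length_pos (by omega : 0 < P.length))
  have h1 : i < collectionStart P ((collectionSize P - 1) + 1) := by
    rw [Nat.sub_add_cancel hpos]
    exact h.trans_le (length_le_collectionStart_collectionSize P)
  have := factorIndex_le_of_lt h1
  omega

/-- Factors that start before the end are nonempty, so moving on by one position cannot skip a
factor. -/
theorem factorIndex_succ {P : List α} {i : ℕ} (h : i + 1 < P.length) :
    factorIndex P (i + 1) = factorIndex P i ∨ factorIndex P (i + 1) = factorIndex P i + 1 := by
  have h1 := lt_collectionStart_factorIndex_succ (P := P) (i := i) (by omega)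
  have h2 : factorIndex P i ≤ factorIndex P (i + 1) :=
    factorIndex_le_of_lt (by have := lt_collectionStart_factorIndex_succ h; omega)
  have h3 : factorIndex P (i + 1) ≤ factorIndex P i + 1 := by
    apply factorIndex_le_of_lt
    by_cases hc : collectionStart P (factorIndex P i + 1) < P.length
    · have := collectionStart_lt_succ hc
      omega
    · have := collectionStart_le_succ P (factorIndex P i + 1)
      omega
  omega

/-- The cuts use the minimum of the three lengths, so a factor is free of repetitions in all three
lanes at once. -/
theorem eq_of_laneString_eq_of_factorIndex_eq {P : List α} {S : Fin 3} {i i' : ℕ} {c : α}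
    (hi : i < P.length) (hi' : i' < P.length) (hf : factorIndex P i = factorIndex P i')
    (h : (laneString P S)[i]? = some c) (h' : (laneString P S)[i']? = some c) : i = i' := by
  have h1 := lt_collectionStart_factorIndex_succ hi
  have h2 := lt_collectionStart_factorIndex_succ hi'
  have h3 := collectionStart_factorIndex_le P i
  have h4 := collectionStart_factorIndex_le P i'
  rw [← hf] at h2 h4
  exact eq_of_getElem?_eq_of_oneLen (collectionStart_succ_le_oneLen P (factorIndex P i) S)
    h3 h4 (by omega) (by omega) h h'

end Factorization

/-! ## The transitions of the swap automaton, arranged in lanes -/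

section Lanes

variable {σ : ℕ}

/-- The transition from `q_p` to `q_q` on the symbol `c` that is attached to position `i` of the
string `laneString P S`. In `P_o` and `P_e` every pair of exchanged symbols carries the two
transitions of a swap. -/
def LaneStep (both : Bool) (P : List (Fin σ)) (S : Fin 3) (i c p q : ℕ) : Prop :=
  ∃ x : Fin σ, (x : ℕ) = c ∧ i < P.length ∧
    ((S = 0 ∧ P[i]? = some x ∧ p = i ∧ q = i + 1) ∨
    (S ≠ 0 ∧ (i + 1) % 2 = (S : ℕ) % 2 ∧ i + 1 < P.length ∧ P[i + 1]? = some x ∧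
      (both = true ∨ P[i]? ≠ some x) ∧ p = i ∧ q = i + P.length + 1) ∨
    (S ≠ 0 ∧ i % 2 = (S : ℕ) % 2 ∧ 1 ≤ i ∧ P[i - 1]? = some x ∧ p = i + P.length ∧ q = i + 1))

/-- This is the purpose of `P_o` and `P_e`: at the two positions of an exchanged pair they show the
symbols in the order in which the swap reads them. -/
theorem LaneStep.laneString_eq {both : Bool} {P : List (Fin σ)} {S : Fin 3} {i c p q : ℕ}
    (h : LaneStep both P S i c p q) :
    ∃ x : Fin σ, (x : ℕ) = c ∧ (laneString P S)[i]? = some x := by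
  obtain ⟨x, hx, hi, h | h | h⟩ := h <;> refine ⟨x, hx, ?_⟩
  · obtain ⟨rfl, h, -⟩ := h
    exact h
  · obtain ⟨hS, hp, hl, h, -⟩ := h
    fin_cases S
    · exact absurd rfl hS
    · rw [← h]
      exact getElem?_pairSwap_even P i (by simp at hp; omega) hl
    · rw [← h]
      exact getElem?_evenString_odd P i (by simp at hp; omega) hl
  · obtain ⟨hS, hp, hl, h, -⟩ := h
    fin_cases S
    · exact absurd rfl hS
    · rw [← h]
      exact getElem?_pairSwap_odd P i (by simp at hp; omega) hi
    · rw [← h]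
      exact getElem?_evenString_even P i (by simp at hp; omega) hl hi

theorem LaneStep.lt {both : Bool} {P : List (Fin σ)} {S : Fin 3} {i c p q : ℕ}
    (h : LaneStep both P S i c p q) : i < P.length := h.choose_spec.2.1

/-- Lane `0` has a single clause; in the other lanes the parity of `i` separates the first
transition of a swap from the second. -/
theorem LaneStep.unique {both : Bool} {P : List (Fin σ)} {S : Fin 3} {i c p q p' q' : ℕ}
    (h : LaneStep both P S i c p q) (h' : LaneStep both P S i c p' q') : p = p' ∧ q = q' := by
  obtain ⟨x, -, hi, h⟩ := h
  obtain ⟨y, -, -, h'⟩ := h'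
  rcases h with h | h | h <;> rcases h' with h' | h' | h' <;> simp_all <;> omega

/-- A target `q ≤ m` forces `i = q - 1`, a larger one forces `i = q - m - 1`; the label is then the
symbol of the lane at `i`. -/
theorem LaneStep.pos_label_unique {both : Bool} {P : List (Fin σ)} {S : Fin 3}
    {i i' c c' p p' q : ℕ} (h : LaneStep both P S i c p q) (h' : LaneStep both P S i' c' p' q) :
    i = i' ∧ c = c' := by
  have hii : i = i' := by
    obtain ⟨x, -, hi, h⟩ := h
    obtain ⟨y, -, hi', h'⟩ := h'
    omega
  subst hii
  obtain ⟨x, hx, e⟩ := h.laneString_eq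
  obtain ⟨y, hy, e'⟩ := h'.laneString_eq
  have := e.symm.trans e'
  simp_all

/-- The possible targets at position `i`, namely `q_{i+1}` and `q_{i+m+1}`, are sources only at
position `i + 1`. The condition `1 ≤ i` in the last clause of `LaneStep` matters here: it excludes
`q_m` as a source. -/
theorem LaneStep.pos_succ {both : Bool} {P : List (Fin σ)} {S S' : Fin 3}
    {i i' c c' p q r : ℕ} (h : LaneStep both P S i c p q) (h' : LaneStep both P S' i' c' q r) :
    i' = i + 1 := by
  obtain ⟨x, -, hi, h⟩ := h
  obtain ⟨y, -, hi', h'⟩ := h'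
  omega

/-- The transitions, with the position replaced by the index of the factor that contains it. -/
def FactorStep (both : Bool) (P : List (Fin σ)) (S : Fin 3) (j c p q : ℕ) : Prop :=
  ∃ i, factorIndex P i = j ∧ LaneStep both P S i c p q

variable {both : Bool} {P : List (Fin σ)}

theorem FactorStep.lt_collectionSize {S : Fin 3} {j c p q : ℕ} (h : FactorStep both P S j c p q) :
    j < collectionSize P := by
  obtain ⟨i, rfl, h⟩ := h
  exact factorIndex_lt_collectionSize h.lt

theorem FactorStep.unique {S : Fin 3} {j c p q p' q' : ℕ} (h : FactorStep both P S j c p q)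
    (h' : FactorStep both P S j c p' q') : p = p' ∧ q = q' := by
  obtain ⟨i, hi, h⟩ := h
  obtain ⟨i', hi', h'⟩ := h'
  obtain ⟨x, hx, e⟩ := h.laneString_eq
  obtain ⟨y, hy, e'⟩ := h'.laneString_eq
  obtain rfl : x = y := Fin.ext (hx.trans hy.symm)
  obtain rfl := eq_of_laneString_eq_of_factorIndex_eq h.lt h'.lt (hi.trans hi'.symm) e e'
  exact h.unique h'

theorem FactorStep.factor_label_unique {S : Fin 3} {j j' c c' p p' q : ℕ}
    (h : FactorStep both P S j c p q) (h' : FactorStep both P S j' c' p' q) :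
    j = j' ∧ c = c' := by
  obtain ⟨i, rfl, h⟩ := h
  obtain ⟨i', rfl, h'⟩ := h'
  obtain ⟨rfl, rfl⟩ := h.pos_label_unique h'
  exact ⟨rfl, rfl⟩

theorem FactorStep.factor_eq_or_succ {S S' : Fin 3} {j j' c c' p q r : ℕ}
    (h : FactorStep both P S j c p q) (h' : FactorStep both P S' j' c' q r) :
    j' = j ∨ j' = j + 1 := by
  obtain ⟨i, rfl, h⟩ := h
  obtain ⟨i', rfl, h'⟩ := h'
  obtain rfl := h.pos_succ h'
  exact factorIndex_succ h'.lt

/-- The numbers of the states reached on `T`. -/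
def reached (both : Bool) (P : List (Fin σ)) (T : List (Fin σ)) : Set ℕ :=
  {n | ∃ q : Fin (2 * P.length), (q : ℕ) = n ∧ q ∈ (swapNFA both P).eval T}

theorem val_mem_reached {T : List (Fin σ)} {q : Fin (2 * P.length)} :
    (q : ℕ) ∈ reached both P T ↔ q ∈ (swapNFA both P).eval T := by
  constructor
  · rintro ⟨q', h, h'⟩
    rwa [← Fin.ext h]
  · exact fun h => ⟨q, rfl, h⟩

theorem mem_reached_nil (hP : P ≠ []) {n : ℕ} : n ∈ reached both P [] ↔ n = 0 := by
  have := List.length_pos_iff.2 hP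
  constructor
  · rintro ⟨q, rfl, h⟩
    exact h
  · rintro rfl
    exact ⟨⟨0, by omega⟩, rfl, rfl⟩

theorem zero_mem_reached (hP : P ≠ []) (T : List (Fin σ)) : 0 ∈ reached both P T := by
  have := List.length_pos_iff.2 hP
  induction T using List.reverseRecOn with
  | nil => exact (mem_reached_nil hP).2 rfl
  | append_singleton T c ih =>
    obtain ⟨q, hq, h⟩ := ih
    refine ⟨⟨0, by omega⟩, rfl, ?_⟩
    rw [NFA.eval_append_singleton, NFA.mem_stepSet]
    exact ⟨q, h, Or.inl ⟨hq, rfl⟩⟩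

theorem mem_reached_append_singleton (hP : P ≠ []) {T : List (Fin σ)} {c : Fin σ} {n : ℕ} :
    n ∈ reached both P (T ++ [c]) ↔
      n = 0 ∨ ∃ S j p, FactorStep both P S j c p n ∧ p ∈ reached both P T := by
  constructor
  · rintro ⟨q', rfl, h⟩
    rw [NFA.eval_append_singleton, NFA.mem_stepSet] at h
    obtain ⟨q, hq, h | h | h | h⟩ := h
    · exact Or.inl h.2
    · obtain ⟨h1, h2, h3⟩ := h
      exact Or.inr ⟨0, _, q, ⟨q, rfl, c, rfl, h1, Or.inl ⟨rfl, h2, rfl, h3⟩⟩, q, rfl, hq⟩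
    · obtain ⟨h1, h2, h3, h4⟩ := h
      -- A swap that starts at an even position belongs to `P_o`, at an odd one to `P_e`.
      refine Or.inr ⟨if (q : ℕ) % 2 = 0 then 1 else 2, _, q,
        ⟨q, rfl, c, rfl, by omega, Or.inr (Or.inl ⟨?_, ?_, h1, h2, h3, rfl, h4⟩)⟩, q, rfl, hq⟩
      · split_ifs <;> decide
      · split_ifs <;> simp <;> omega
    · obtain ⟨h1, h2, h3⟩ := h
      have := q.2
      -- Here the position `q - m` is the second one of the exchanged pair, so the parities are
      -- reversed.
      refine Or.inr ⟨if ((q : ℕ) - P.length) % 2 = 0 then 2 else 1, _, q,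
        ⟨q - P.length, rfl, c, rfl, by omega,
          Or.inr (Or.inr ⟨?_, ?_, by omega, h2, by omega, h3⟩)⟩, q, rfl, hq⟩
      · split_ifs <;> decide
      · split_ifs <;> simp <;> omega
  · rintro (rfl | ⟨S, j, p, ⟨i, -, x, hx, hi, h⟩, q, rfl, hq⟩)
    · exact zero_mem_reached hP _
    · obtain rfl := Fin.ext hx
      refine ⟨⟨n, by omega⟩, rfl, ?_⟩
      rw [NFA.eval_append_singleton, NFA.mem_stepSet]
      refine ⟨q, hq, ?_⟩
      rcases h with h | h | h
      · obtain ⟨-, h, h1, h2⟩ := h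
        exact Or.inr (Or.inl ⟨by omega, by rwa [h1], by simp only; omega⟩)
      · obtain ⟨-, -, h1, h2, h3, h4, h5⟩ := h
        exact Or.inr (Or.inr (Or.inl ⟨by omega, by rwa [h4], by rwa [h4], by simp only; omega⟩))
      · obtain ⟨-, -, h1, h2, h3, h4⟩ := h
        refine Or.inr (Or.inr (Or.inr ⟨by omega, ?_, by simp only; omega⟩))
        rwa [show (q : ℕ) - P.length - 1 = i - 1 by omega]

/-- Bit `j` of the vector of lane `S` after reading `T`. -/
def LaneBit (both : Bool) (P : List (Fin σ)) (T : List (Fin σ)) (S : Fin 3) (j : ℕ) : Prop :=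
  ∃ (T' : List (Fin σ)) (c : Fin σ) (p q : ℕ),
    T = T' ++ [c] ∧ FactorStep both P S j c p q ∧ p ∈ reached both P T'

theorem not_laneBit_nil (S : Fin 3) (j : ℕ) : ¬ LaneBit both P [] S j := by
  rintro ⟨T', c, p, q, h, -⟩
  simp at h

/-- The operands that contribute to the new vectors: all ones (`none`), the old vector of a lane
(`some (false, S)`), and the same vector shifted by one factor (`some (true, S)`). `TransMask`
says which bits of the operand count if the symbol `a` is followed by `c`. -/
def TransMask (both : Bool) (P : List (Fin σ)) (a c : ℕ) (S' : Fin 3) (j : ℕ) :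
    Option (Bool × Fin 3) → Prop
  | none => ∃ r, FactorStep both P S' j c 0 r
  | some (false, S) => ∃ p q r, FactorStep both P S j a p q ∧ FactorStep both P S' j c q r
  | some (true, S) => ∃ j₀ p q r, j = j₀ + 1 ∧ FactorStep both P S j₀ a p q ∧
      FactorStep both P S' j c q r

/-- The bit of an operand, if `O` are the bits of the old vectors. -/
def operandBit (O : Fin 3 → ℕ → Prop) (j : ℕ) : Option (Bool × Fin 3) → Prop
  | none => True
  | some (false, S) => O S j
  | some (true, S) => ∃ j₀, j = j₀ + 1 ∧ O S j₀

/-- The source of the new transition is `q_0` or was entered on `a`, from the same factor or the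
preceding one. For empty `T` the symbol `a` is arbitrary: the old bits vanish, and only the operand
`none` contributes. -/
theorem laneBit_append_singleton (hP : P ≠ []) {T : List (Fin σ)} {a : ℕ}
    (ha : ∀ x, T.getLast? = some x → (x : ℕ) = a) (c : Fin σ) (S' : Fin 3) (j : ℕ) :
    LaneBit both P (T ++ [c]) S' j ↔
      ∃ o, TransMask both P a c S' j o ∧ operandBit (LaneBit both P T) j o := by
  constructor
  · rintro ⟨T', c', p, q, e, h, hp⟩
    obtain ⟨rfl, e⟩ := List.append_inj' e rfl
    obtain rfl : c = c' := by simpa using e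
    rcases T.eq_nil_or_concat' with rfl | ⟨T₀, x, rfl⟩
    · obtain rfl := (mem_reached_nil hP).1 hp
      exact ⟨none, ⟨q, h⟩, trivial⟩
    · obtain rfl := ha x (by simp)
      rcases (mem_reached_append_singleton hP).1 hp with rfl | ⟨S, j₀, p', h', hp'⟩
      · exact ⟨none, ⟨q, h⟩, trivial⟩
      · rcases h'.factor_eq_or_succ h with rfl | rfl
        · exact ⟨some (false, S), ⟨p', p, q, h', h⟩, T₀, x, p', p, rfl, h', hp'⟩
        · exact ⟨some (true, S), ⟨j₀, p', p, q, rfl, h', h⟩, j₀, rfl, T₀, x, p', p, rfl, h', hp'⟩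
  · rintro ⟨o, hm, ho⟩
    match o, hm, ho with
    | none, ⟨r, h⟩, _ => exact ⟨T, c, 0, r, rfl, h, zero_mem_reached hP T⟩
    | some (false, S), ⟨p, q, r, h, h'⟩, ⟨T₀, x, p₁, q₁, e, h₁, hp⟩ =>
      subst e
      obtain rfl := ha x (by simp)
      -- The old bit says that some transition on `a` in this factor was taken; by uniqueness it is
      -- the one that the mask speaks of.
      obtain ⟨rfl, rfl⟩ := h.unique h₁
      exact ⟨_, c, q, r, rfl, h', (mem_reached_append_singleton hP).2 (Or.inr ⟨_, _, _, h, hp⟩)⟩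
    | some (true, S), ⟨j₀, p, q, r, e₀, h, h'⟩, ⟨j₁, e₁, T₀, x, p₁, q₁, e, h₁, hp⟩ =>
      subst e
      obtain rfl := ha x (by simp)
      obtain rfl : j₀ = j₁ := by omega
      obtain ⟨rfl, rfl⟩ := h.unique h₁
      exact ⟨_, c, q, r, rfl, h', (mem_reached_append_singleton hP).2 (Or.inr ⟨_, _, _, h, hp⟩)⟩

theorem mem_reached_iff_laneBit (hP : P ≠ []) {T : List (Fin σ)} {n : ℕ} :
    n ∈ reached both P T ↔ n = 0 ∨ ∃ c S j p, T.getLast? = some c ∧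
      FactorStep both P S j c p n ∧ LaneBit both P T S j := by
  rcases T.eq_nil_or_concat' with rfl | ⟨T, c, rfl⟩
  · simp [mem_reached_nil hP]
  · rw [mem_reached_append_singleton hP]
    refine or_congr Iff.rfl ⟨?_, ?_⟩
    · rintro ⟨S, j, p, h, hp⟩
      exact ⟨c, S, j, p, by simp, h, T, c, p, n, rfl, h, hp⟩
    · rintro ⟨c', S, j, p, e, h, T', c₁, p₁, n₁, e₁, h₁, hp⟩
      obtain rfl : c = c' := by simpa using e
      obtain ⟨rfl, e⟩ := List.append_inj' e₁ rfl
      obtain rfl : c = c₁ := by simpa using e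
      obtain ⟨rfl, rfl⟩ := h.unique h₁
      exact ⟨S, j, p, h, hp⟩

theorem mem_accepts_iff_length_mem_reached {T : List (Fin σ)} :
    T ∈ (swapNFA both P).accepts ↔ P.length ∈ reached both P T := by
  constructor
  · rintro ⟨q, hq, h⟩
    exact ⟨q, hq, h⟩
  · rintro ⟨q, hq, h⟩
    exact ⟨q, hq, h⟩

end Lanes

/-! ## Straight-line programs and loops -/

section Machine

variable {w s R : ℕ}

/-- Straight-line code. -/
def RamProg.straight (i : RamInstr R) : List (RamInstr R) → RamProg R
  | [] => .instr i
  | j :: l => .seq (.instr i) (RamProg.straight j l)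

/-- The weakest precondition of a straight-line program: it halts, and then `Q` holds. -/
def RamInstr.wp : List (RamInstr R) → (RamState w s R → Prop) → RamState w s R → Prop
  | [], Q, st => Q st
  | i :: l, Q, st => ∃ st', i.exec st = some st' ∧ RamInstr.wp l Q st'

open RamInstr

/-- Straight-line code takes one step per instruction, so `wp` need not keep track of time. -/
theorem exists_ramRun_straight {i : RamInstr R} {l : List (RamInstr R)}
    {Q : RamState w s R → Prop} {st : RamState w s R} (h : wp (i :: l) Q st) :
    ∃ st', RamRun (.straight i l) st (l.length + 1) st' ∧ Q st' := by
  induction l generalizing i st with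
  | nil =>
    obtain ⟨st', h, hQ⟩ := h
    exact ⟨st', .instr h, hQ⟩
  | cons j l ih =>
    obtain ⟨st₁, h, h'⟩ := h
    obtain ⟨st₂, h₂, hQ⟩ := ih h'
    refine ⟨st₂, ?_, hQ⟩
    have := RamRun.seq (.instr h) h₂
    rwa [add_comm 1] at this

theorem wp_append (l l' : List (RamInstr R)) (Q : RamState w s R → Prop) (st : RamState w s R) :
    wp (l ++ l') Q st ↔ wp l (wp l' Q) st := by
  induction l generalizing st with
  | nil => rfl
  | cons i l ih => simp [wp, ih]

theorem wp_mono {l : List (RamInstr R)} {Q Q' : RamState w s R → Prop} {st : RamState w s R}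
    (h : wp l Q st) (hQ : ∀ st', Q st' → Q' st') : wp l Q' st := by
  induction l generalizing st with
  | nil => exact hQ _ h
  | cons i l ih =>
    obtain ⟨st', h₁, h₂⟩ := h
    exact ⟨st', h₁, ih h₂⟩

/-- The content of cell `x`, and `0` if there is no such cell. -/
def RamState.cell (st : RamState w s R) (x : ℕ) : BitVec w :=
  if h : x < s then st.mem ⟨x, h⟩ else 0

theorem wp_nil (Q : RamState w s R → Prop) (st : RamState w s R) : wp [] Q st ↔ Q st := Iff.rfl

variable (l : List (RamInstr R)) (Q : RamState w s R → Prop) (st : RamState w s R)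

theorem exists_setIdx_iff (d : Fin R) (v : ℕ) (Q : RamState w s R → Prop) :
    (∃ st', st.setIdx d v = some st' ∧ Q st') ↔
      v ≤ max s w ∧ Q { st with idx := Function.update st.idx d v } := by
  unfold RamState.setIdx
  split_ifs with h <;> simp [h]

theorem wp_iconst (d : Fin R) (n : ℕ) : wp (iconst d n :: l) Q st ↔
    n ≤ max s w ∧ wp l Q { st with idx := Function.update st.idx d n } :=
  exists_setIdx_iff st d _ _

theorem wp_iadd (d a b : Fin R) : wp (iadd d a b :: l) Q st ↔
    st.idx a + st.idx b ≤ max s w ∧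
      wp l Q { st with idx := Function.update st.idx d (st.idx a + st.idx b) } :=
  exists_setIdx_iff st d _ _

theorem wp_imul (d a b : Fin R) : wp (imul d a b :: l) Q st ↔
    st.idx a * st.idx b ≤ max s w ∧
      wp l Q { st with idx := Function.update st.idx d (st.idx a * st.idx b) } :=
  exists_setIdx_iff st d _ _

theorem wp_wconst (d : Fin R) (n : ℕ) : wp (wconst d n :: l) Q st ↔
    wp l Q { st with wd := Function.update st.wd d (BitVec.ofNat w n) } := by
  simp [wp, exec, RamState.setWd]

theorem wp_and (d a b : Fin R) : wp (.and d a b :: l) Q st ↔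
    wp l Q { st with wd := Function.update st.wd d (st.wd a &&& st.wd b) } := by
  simp [wp, exec, RamState.setWd]

theorem wp_or (d a b : Fin R) : wp (.or d a b :: l) Q st ↔
    wp l Q { st with wd := Function.update st.wd d (st.wd a ||| st.wd b) } := by
  simp [wp, exec, RamState.setWd]

theorem wp_shl (d a b : Fin R) : wp (shl d a b :: l) Q st ↔
    wp l Q { st with wd := Function.update st.wd d (st.wd a <<< st.idx b) } := by
  simp [wp, exec, RamState.setWd]

theorem wp_shr (d a b : Fin R) : wp (shr d a b :: l) Q st ↔
    wp l Q { st with wd := Function.update st.wd d (st.wd a >>> st.idx b) } := by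
  simp [wp, exec, RamState.setWd]

theorem wp_load (d a : Fin R) : wp (load d a :: l) Q st ↔
    st.idx a < s ∧ wp l Q { st with wd := Function.update st.wd d (st.cell (st.idx a)) } := by
  by_cases h : st.idx a < s <;> simp [wp, exec, RamState.setWd, RamState.cell, h]

/-- Write to a memory cell. -/
def RamState.setCell (st : RamState w s R) (x : ℕ) (v : BitVec w) : RamState w s R :=
  { st with mem := fun y => if (y : ℕ) = x then v else st.mem y }

theorem wp_store (a b : Fin R) : wp (store a b :: l) Q st ↔
    st.idx a < s ∧ wp l Q (st.setCell (st.idx a) (st.wd b)) := by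
  by_cases h : st.idx a < s
  · have : (fun y : Fin s => if (y : ℕ) = st.idx a then st.wd b else st.mem y) =
        Function.update st.mem ⟨st.idx a, h⟩ (st.wd b) := by
      funext y
      simp [Function.update_apply, Fin.ext_iff]
    simp [wp, exec, h, RamState.setCell, this]
  · simp [wp, exec, h]

theorem RamState.cell_setCell (st : RamState w s R) (x : ℕ) (v : BitVec w) (hx : x < s) (y : ℕ) :
    (st.setCell x v).cell y = if y = x then v else st.cell y := by
  unfold RamState.cell RamState.setCell
  by_cases hy : y < s
  · simp [hy]
  · simp only [hy, dif_neg, not_false_iff]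
    rw [if_neg (by omega)]

/-- A loop of `K` rounds. -/
theorem exists_ramRun_whileLt {a b : Fin R} {p : RamProg R} (I : ℕ → RamState w s R → Prop)
    (K u : ℕ) (hlt : ∀ t < K, ∀ st, I t st → st.idx a < st.idx b)
    (hend : ∀ st, I K st → ¬ st.idx a < st.idx b)
    (hstep : ∀ t < K, ∀ st, I t st → ∃ st', RamRun p st u st' ∧ I (t + 1) st')
    (st : RamState w s R) (h : I 0 st) :
    ∃ st', RamRun (.whileLt a b p) st (K * (u + 1) + 1) st' ∧ I K st' := by
  suffices H : ∀ n t, t + n = K → ∀ st, I t st →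
      ∃ st', RamRun (.whileLt a b p) st (n * (u + 1) + 1) st' ∧ I K st' from
    H K 0 (by omega) st h
  intro n
  induction n with
  | zero =>
    rintro t rfl st h
    exact ⟨st, by simpa using RamRun.whileLt_false (hend st h), h⟩
  | succ n ih =>
    intro t ht st h
    obtain ⟨st₁, h₁, I₁⟩ := hstep t (by omega) st h
    obtain ⟨st₂, h₂, I₂⟩ := ih (t + 1) (by omega) st₁ I₁
    refine ⟨st₂, ?_, I₂⟩
    have := RamRun.whileLt_true (hlt t (by omega) st h) h₁ h₂
    rwa [show u + (n * (u + 1) + 1) + 1 = (n + 1) * (u + 1) + 1 by ring] at this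

/-- For all `(a, b)` in the list: `b := b or (a and mask)`, where the masks are read from
consecutive cells, with the pointer `p`; the register `x` is scratch, and `one` holds `1`. -/
def maskedOr (p one x : Fin R) (L : List (Fin R × Fin R)) : List (RamInstr R) :=
  L.flatMap fun e => [load x p, .and x x e.1, .or e.2 e.2 x, iadd p p one]

/-- No register read as an operand is ever a target, so all conjunctions use the initial contents;
the order of the list only fixes the addresses of the masks. -/
theorem wp_maskedOr {p one x : Fin R} (hp : p ≠ one) (L : List (Fin R × Fin R))
    (hL : ∀ e ∈ L, e.1 ≠ x ∧ e.2 ≠ x ∧ ∀ e' ∈ L, e'.2 ≠ e.1) (st : RamState w s R)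
    (h1 : st.idx one = 1) (hs : st.idx p + L.length ≤ s) :
    wp (maskedOr p one x L) (fun st' =>
      st'.mem = st.mem ∧
      st'.idx = Function.update st.idx p (st.idx p + L.length) ∧
      (∀ r, r ≠ x → (∀ e ∈ L, e.2 ≠ r) → st'.wd r = st.wd r) ∧
      ∀ r, r ≠ x → ∀ b, (st'.wd r).getLsbD b = true ↔ (st.wd r).getLsbD b = true ∨
        ∃ i a, L[i]? = some (a, r) ∧ (st.cell (st.idx p + i)).getLsbD b = true ∧
          (st.wd a).getLsbD b = true) st := by
  induction L generalizing st with
  | nil => simp [maskedOr, wp]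
  | cons e L ih =>
    obtain ⟨a, d⟩ := e
    simp only [List.length_cons] at hs
    obtain ⟨ha, hd, hda⟩ := hL (a, d) (by simp)
    simp only at ha hd
    have hda' := hda (a, d) (by simp)
    simp only at hda'
    have hh : maskedOr p one x ((a, d) :: L) =
      [load x p, .and x x a, .or d d x, iadd p p one] ++ maskedOr p one x L := rfl
    rw [hh, wp_append]
    simp only [wp_load, wp_and, wp_or, wp_iadd, wp_nil, h1]
    refine ⟨by omega, le_max_of_le_left (by omega), ?_⟩
    refine wp_mono (ih (fun e he => ⟨(hL e (by simp [he])).1, (hL e (by simp [he])).2.1,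
      fun e' he' => (hL e (by simp [he])).2.2 e' (by simp [he'])⟩) _ ?_ ?_) ?_
    · simp [Function.update_of_ne hp.symm, h1]
    · simp
      omega
    rintro st' ⟨e1, e2, e3, e4⟩
    refine ⟨e1, ?_, ?_, ?_⟩
    · rw [e2]
      simp [add_assoc, add_comm 1]
    · intro r hr h
      rw [e3 r hr (fun e he => h e (by simp [he]))]
      have := h (a, d) (by simp)
      simp only at this
      simp [Function.update_of_ne this.symm, Function.update_of_ne hr]
    · intro r hr b
      rw [e4 r hr b]
      have hw : ∀ y, y ≠ x → y ≠ d → Function.update (Function.update (Function.update st.wd x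
          (st.cell (st.idx p))) x (st.cell (st.idx p) &&& st.wd a)) d
          (st.wd d ||| st.cell (st.idx p) &&& st.wd a) y = st.wd y := by
        intro y h1 h2
        simp [Function.update_of_ne h2, Function.update_of_ne h1]
      have hwL : ∀ (i : ℕ) (y r : Fin R), L[i]? = some (y, r) → y ≠ x ∧ y ≠ d := by
        intro i y r hi
        have hm := List.mem_of_getElem? hi
        exact ⟨(hL (y, r) (by simp [hm])).1, ((hL (y, r) (by simp [hm])).2.2 (a, d) (by simp)).symm⟩
      have hidx : ∀ i, st.idx p + 1 + i = st.idx p + (i + 1) := by intro i; omega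
      constructor
      · rintro (h | ⟨i, y, h, hm, hb⟩)
        · by_cases hrd : r = d
          · subst hrd
            simp [Function.update_of_ne hd, Function.update_of_ne ha] at h
            rcases h with h | h
            · exact Or.inl h
            · exact Or.inr ⟨0, a, by simp, h.1, h.2⟩
          · simp [Function.update_of_ne hrd, Function.update_of_ne hr] at h
            exact Or.inl h
        · obtain ⟨hy1, hy2⟩ := hwL i y r h
          refine Or.inr ⟨i + 1, y, by simpa using h, ?_, ?_⟩
          · simpa [hidx, RamState.cell] using hm
          · simpa [Function.update_of_ne hy1, Function.update_of_ne hy2] using hb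
      · rintro (h | ⟨i, y, h, hm, hb⟩)
        · left
          by_cases hrd : r = d
          · subst hrd
            simp [Function.update_of_ne hd, Function.update_of_ne ha, h]
          · simpa [Function.update_of_ne hrd, Function.update_of_ne hr] using h
        · rcases i with _ | i
          · obtain ⟨rfl, rfl⟩ : a = y ∧ d = r := by simpa using h
            left
            simp only [add_zero] at hm
            simp [Function.update_of_ne hd, Function.update_of_ne ha, hm, hb]
          · simp only [List.getElem?_cons_succ] at h
            obtain ⟨hy1, hy2⟩ := hwL i y r h
            refine Or.inr ⟨i, y, h, ?_, ?_⟩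
            · simpa [hidx, RamState.cell] using hm
            · simpa [Function.update_of_ne hy1, Function.update_of_ne hy2] using hb

end Machine

/-! ## The program -/

section Program

open RamInstr

/-- Word registers for the old vectors. -/
def oldReg (S : Fin 3) : Fin 16 := ⟨S, by omega⟩

/-- Word registers for the old vectors, shifted by one bit. -/
def shiftReg (S : Fin 3) : Fin 16 := ⟨3 + S, by omega⟩

/-- Word registers for the new vectors. -/
def newReg (S : Fin 3) : Fin 16 := ⟨6 + S, by omega⟩

/-- Word registers for the preceding words of the old vectors. -/
def prevReg (S : Fin 3) : Fin 16 := ⟨9 + S, by omega⟩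

/-- The register that holds an operand. -/
def operandReg : Option (Bool × Fin 3) → Fin 16
  | none => 14
  | some (false, S) => oldReg S
  | some (true, S) => shiftReg S

/-- Fetch one word of the vector of lane `S`. -/
def fetchLane (S : Fin 3) : List (RamInstr 16) :=
  [load (oldReg S) 8, iadd 8 8 5, shl (shiftReg S) (oldReg S) 5, shr 13 (prevReg S) 6,
    .or (shiftReg S) (shiftReg S) 13, .or (prevReg S) (oldReg S) (oldReg S), wconst (newReg S) 0]

/-- Store one word of the vector of lane `S`. -/
def storeLane (S : Fin 3) : List (RamInstr 16) := [store 9 (newReg S), iadd 9 9 5]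

/-- The pairs of an operand and a target lane, in the order of their masks in memory. -/
def operandTargets : List (Option (Bool × Fin 3) × Fin 3) :=
  [none, some (false, 0), some (false, 1), some (false, 2), some (true, 0), some (true, 1),
    some (true, 2)] ×ˢ [0, 1, 2]

/-- The registers of `operandTargets`. -/
def operandTargetRegs : List (Fin 16 × Fin 16) :=
  operandTargets.map fun e => (operandReg e.1, newReg e.2)

/-- The registers for the test of acceptance. -/
def acceptRegs : List (Fin 16 × Fin 16) :=
  ([0, 1, 2] : List (Fin 3)).map fun S => (newReg S, 12)

/-- Fetch one word of every lane. -/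
def fetchCode : List (RamInstr 16) := fetchLane 0 ++ (fetchLane 1 ++ fetchLane 2)

/-- Store one word of every lane. -/
def storeCode : List (RamInstr 16) := storeLane 0 ++ (storeLane 1 ++ storeLane 2)

/-- Update one word of every lane. -/
def bodyCode : List (RamInstr 16) :=
  fetchCode ++ (maskedOr 7 5 13 operandTargetRegs ++ (maskedOr 7 5 13 acceptRegs ++ storeCode))

variable {w s : ℕ}

/-- What `fetchLane` computes. -/
theorem wp_fetchLane (S : Fin 3) (st : RamState w s 16) (h1 : st.idx 5 = 1)
    (hs : st.idx 8 + 1 ≤ s) :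
    wp (fetchLane S) (fun st' => st'.mem = st.mem ∧
      st'.idx = Function.update st.idx 8 (st.idx 8 + 1) ∧
      st'.wd (oldReg S) = st.cell (st.idx 8) ∧
      st'.wd (shiftReg S) = (st.cell (st.idx 8) <<< 1 ||| st.wd (prevReg S) >>> st.idx 6) ∧
      st'.wd (prevReg S) = st.cell (st.idx 8) ∧ st'.wd (newReg S) = 0 ∧
      ∀ r, r ≠ oldReg S → r ≠ shiftReg S → r ≠ prevReg S → r ≠ newReg S → r ≠ 13 →
        st'.wd r = st.wd r) st := by
  have h8 : st.idx 8 + 1 ≤ max s w := le_max_of_le_left hs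
  simp only [fetchLane, wp_load, wp_iadd, wp_shl, wp_shr, wp_or, wp_wconst, wp_nil, h1]
  have d1 : oldReg S ≠ shiftReg S := by fin_cases S <;> decide
  have d2 : oldReg S ≠ prevReg S := by fin_cases S <;> decide
  have d3 : oldReg S ≠ newReg S := by fin_cases S <;> decide
  have d4 : oldReg S ≠ 13 := by fin_cases S <;> decide
  have d5 : shiftReg S ≠ prevReg S := by fin_cases S <;> decide
  have d6 : shiftReg S ≠ newReg S := by fin_cases S <;> decide
  have d7 : shiftReg S ≠ 13 := by fin_cases S <;> decide
  have d8 : prevReg S ≠ newReg S := by fin_cases S <;> decide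
  have d9 : prevReg S ≠ 13 := by fin_cases S <;> decide
  refine ⟨hs, h8, trivial, trivial, ?_, ?_, ?_, ?_, ?_⟩
  · simp [d1, d2, d3, d4]
  · simp [d2.symm, d5, d6, d7, d1, d4, d5.symm, h1]
  · simp [d8, d1, d4]
  · simp
  · intro r h1 h2 h3 h4 h5
    simp [h1, h2, h3, h4, h5]

theorem wp_fetchCode (st : RamState w s 16) (h1 : st.idx 5 = 1) (hs : st.idx 8 + 3 ≤ s) :
    wp fetchCode (fun st' => st'.mem = st.mem ∧
      st'.idx = Function.update st.idx 8 (st.idx 8 + 3) ∧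
      (∀ S : Fin 3, st'.wd (oldReg S) = st.cell (st.idx 8 + S) ∧
        st'.wd (shiftReg S) =
          (st.cell (st.idx 8 + S) <<< 1 ||| st.wd (prevReg S) >>> st.idx 6) ∧
        st'.wd (prevReg S) = st.cell (st.idx 8 + S) ∧ st'.wd (newReg S) = 0) ∧
      st'.wd 12 = st.wd 12 ∧ st'.wd 14 = st.wd 14) st := by
  rw [fetchCode, wp_append]
  refine wp_mono (wp_fetchLane 0 st h1 (by omega)) ?_
  rintro st₁ ⟨m₁, i₁, a₁, b₁, c₁, e₁, f₁⟩
  have k₁ : st₁.idx 8 = st.idx 8 + 1 := by simp [i₁]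
  rw [wp_append]
  refine wp_mono (wp_fetchLane 1 st₁ (by simp [i₁, h1]) (by omega)) ?_
  rintro st₂ ⟨m₂, i₂, a₂, b₂, c₂, e₂, f₂⟩
  have k₂ : st₂.idx 8 = st.idx 8 + 2 := by simp [i₂, k₁]
  refine wp_mono (wp_fetchLane 2 st₂ (by simp [i₂, i₁, h1]) (by omega)) ?_
  rintro st₃ ⟨m₃, i₃, a₃, b₃, c₃, e₃, f₃⟩
  have hc₁ : st₁.cell = st.cell := by funext x; simp [RamState.cell, m₁]
  have hc₂ : st₂.cell = st.cell := by funext x; simp [RamState.cell, m₂, m₁]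
  have h6₁ : st₁.idx 6 = st.idx 6 := by simp [i₁]
  have h6₂ : st₂.idx 6 = st.idx 6 := by simp [i₂, h6₁]
  refine ⟨by rw [m₃, m₂, m₁], by simp [i₃, i₂, i₁], ?_, ?_, ?_⟩
  · intro S
    fin_cases S
    · simp only [Fin.zero_eta, add_zero]
      refine ⟨?_, ?_, ?_, ?_⟩
      · rw [f₃, f₂, a₁] <;> decide
      · rw [f₃, f₂, b₁] <;> decide
      · rw [f₃, f₂, c₁] <;> decide
      · rw [f₃, f₂, e₁] <;> decide
    · simp only [Fin.mk_one]
      rw [← k₁, ← hc₁]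
      refine ⟨?_, ?_, ?_, ?_⟩
      · rw [f₃, a₂] <;> decide
      · rw [f₃, b₂, f₁, h6₁] <;> decide
      · rw [f₃, c₂] <;> decide
      · rw [f₃, e₂] <;> decide
    · simp only [Fin.reduceFinMk]
      rw [← k₂, ← hc₂]
      refine ⟨a₃, ?_, c₃, e₃⟩
      rw [b₃, f₂, f₁, h6₂] <;> decide
  · rw [f₃, f₂, f₁] <;> decide
  · rw [f₃, f₂, f₁] <;> decide

theorem wp_storeLane (S : Fin 3) (st : RamState w s 16) (h1 : st.idx 5 = 1)
    (hs : st.idx 9 + 1 ≤ s) :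
    wp (storeLane S) (fun st' => st'.wd = st.wd ∧
      st'.idx = Function.update st.idx 9 (st.idx 9 + 1) ∧
      ∀ x, st'.cell x = if x = st.idx 9 then st.wd (newReg S) else st.cell x) st := by
  simp only [storeLane, wp_store, wp_iadd, wp_nil]
  refine ⟨hs, ?_, rfl, ?_, fun x => ?_⟩
  · exact le_max_of_le_left (by rw [show (st.setCell _ _).idx = st.idx from rfl, h1]; exact hs)
  · rw [show (st.setCell _ _).idx = st.idx from rfl, h1]
  · exact st.cell_setCell _ _ hs x

theorem wp_storeCode (st : RamState w s 16) (h1 : st.idx 5 = 1) (hs : st.idx 9 + 3 ≤ s) :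
    wp storeCode (fun st' => st'.wd = st.wd ∧
      st'.idx = Function.update st.idx 9 (st.idx 9 + 3) ∧
      (∀ S : Fin 3, st'.cell (st.idx 9 + S) = st.wd (newReg S)) ∧
      ∀ x, (∀ S : Fin 3, x ≠ st.idx 9 + S) → st'.cell x = st.cell x) st := by
  rw [storeCode, wp_append]
  refine wp_mono (wp_storeLane 0 st h1 (by omega)) ?_
  rintro st₁ ⟨w₁, i₁, c₁⟩
  have k₁ : st₁.idx 9 = st.idx 9 + 1 := by simp [i₁]
  rw [wp_append]
  refine wp_mono (wp_storeLane 1 st₁ (by simp [i₁, h1]) (by omega)) ?_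
  rintro st₂ ⟨w₂, i₂, c₂⟩
  have k₂ : st₂.idx 9 = st.idx 9 + 2 := by simp [i₂, k₁]
  refine wp_mono (wp_storeLane 2 st₂ (by simp [i₂, i₁, h1]) (by omega)) ?_
  rintro st₃ ⟨w₃, i₃, c₃⟩
  refine ⟨by rw [w₃, w₂, w₁], by simp [i₃, i₂, i₁], ?_, ?_⟩
  · intro S
    rw [c₃, c₂, c₁, k₂, k₁, w₂, w₁]
    fin_cases S <;> simp
  · intro x hx
    have h0 := hx 0
    have h1 := hx 1
    have h2 := hx 2
    simp only [Fin.val_zero, Fin.val_one, Fin.val_two, add_zero] at h0 h1 h2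
    rw [c₃, c₂, c₁, k₂, k₁, if_neg h2, if_neg h1, if_neg h0]

/-- The words that the operands hold after `fetchCode`. -/
def operandWord (st : RamState w s 16) : Option (Bool × Fin 3) → BitVec w
  | none => st.wd 14
  | some (false, S) => st.cell (st.idx 8 + S)
  | some (true, S) => st.cell (st.idx 8 + S) <<< 1 ||| st.wd (prevReg S) >>> st.idx 6

theorem snd_ne_of_mem_operandTargetRegs {r : Fin 16} (h : ∀ S, newReg S ≠ r) :
    ∀ e ∈ operandTargetRegs, e.2 ≠ r := by
  intro e he
  obtain ⟨_, -, rfl⟩ := List.mem_map.1 he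
  exact h _

theorem snd_ne_of_mem_acceptRegs {r : Fin 16} (h : 12 ≠ r) : ∀ e ∈ acceptRegs, e.2 ≠ r := by
  intro e he
  obtain ⟨_, -, rfl⟩ := List.mem_map.1 he
  exact h

theorem operandTargetRegs_disjoint :
    ∀ e ∈ operandTargetRegs, e.1 ≠ 13 ∧ e.2 ≠ 13 ∧ ∀ e' ∈ operandTargetRegs, e'.2 ≠ e.1 := by
  intro e he
  obtain ⟨⟨o, S⟩, -, rfl⟩ := List.mem_map.1 he
  have h1 : ∀ o, operandReg o ≠ 13 := by decide
  have h2 : ∀ S, newReg S ≠ 13 := by decide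
  have h3 : ∀ o S, newReg S ≠ operandReg o := by decide
  exact ⟨h1 o, h2 S, snd_ne_of_mem_operandTargetRegs (h3 o)⟩

theorem acceptRegs_disjoint :
    ∀ e ∈ acceptRegs, e.1 ≠ 13 ∧ e.2 ≠ 13 ∧ ∀ e' ∈ acceptRegs, e'.2 ≠ e.1 := by
  intro e he
  obtain ⟨S, -, rfl⟩ := List.mem_map.1 he
  have h1 : ∀ S, newReg S ≠ 13 := by decide
  have h2 : ∀ S, 12 ≠ newReg S := by decide
  have h3 : (12 : Fin 16) ≠ 13 := by decide
  exact ⟨h1 S, h3, snd_ne_of_mem_acceptRegs (h2 S)⟩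

/-- Index registers: `5` holds `1`, `6` holds `w - 1` in the application, `7` points to the masks,
`8` and `9` are the read and write pointers into the vectors. Word registers: `12` collects the
accepting bits, `13` is scratch, `14` is the operand `none`. A block consists of 21 transition masks
and 3 acceptance masks. -/
theorem wp_bodyCode (st : RamState w s 16) (h1 : st.idx 5 = 1) (h7 : st.idx 7 + 24 ≤ s)
    (h8 : st.idx 8 + 3 ≤ s) (h9 : st.idx 9 + 3 ≤ s) :
    wp bodyCode (fun st' =>
      st'.idx = Function.update (Function.update (Function.update st.idx 8 (st.idx 8 + 3))
        7 (st.idx 7 + 24)) 9 (st.idx 9 + 3) ∧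
      (∀ S, st'.wd (prevReg S) = st.cell (st.idx 8 + S)) ∧ st'.wd 14 = st.wd 14 ∧
      (∀ (S : Fin 3) b, (st'.cell (st.idx 9 + S)).getLsbD b = true ↔
        ∃ (i : ℕ) (o : _), operandTargets[i]? = some (o, S) ∧
          (st.cell (st.idx 7 + i)).getLsbD b = true ∧ (operandWord st o).getLsbD b = true) ∧
      (∀ b, (st'.wd 12).getLsbD b = true ↔ (st.wd 12).getLsbD b = true ∨
        ∃ S : Fin 3, (st.cell (st.idx 7 + 21 + S)).getLsbD b = true ∧
          (st'.cell (st.idx 9 + S)).getLsbD b = true) ∧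
      ∀ x, (∀ S : Fin 3, x ≠ st.idx 9 + S) → st'.cell x = st.cell x) st := by
  rw [bodyCode, wp_append]
  refine wp_mono (wp_fetchCode st h1 h8) ?_
  rintro st₁ ⟨m₁, i₁, a₁, b₁, c₁⟩
  have h7₁ : st₁.idx 7 = st.idx 7 := by simp [i₁]
  have hc₁ : st₁.cell = st.cell := by funext x; simp [RamState.cell, m₁]
  rw [wp_append]
  refine wp_mono (wp_maskedOr (by decide) operandTargetRegs operandTargetRegs_disjoint st₁ (by simp [i₁, h1])
    (by rw [h7₁]; exact le_trans (by simp [operandTargetRegs, operandTargets]) h7)) ?_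
  rintro st₂ ⟨m₂, i₂, a₂, b₂⟩
  have h7₂ : st₂.idx 7 = st.idx 7 + 21 := by
    simp [i₂, h7₁, operandTargetRegs, operandTargets]
  have hc₂ : st₂.cell = st.cell := by rw [← hc₁]; funext x; simp [RamState.cell, m₂]
  rw [wp_append]
  refine wp_mono (wp_maskedOr (by decide) acceptRegs acceptRegs_disjoint st₂ (by simp [i₂, i₁, h1])
    (by rw [h7₂]; exact le_trans (by simp [acceptRegs]) h7)) ?_
  rintro st₃ ⟨m₃, i₃, a₃, b₃⟩
  have hc₃ : st₃.cell = st.cell := by rw [← hc₂]; funext x; simp [RamState.cell, m₃]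
  have h9₃ : st₃.idx 9 = st.idx 9 := by simp [i₃, i₂, i₁]
  refine wp_mono (wp_storeCode st₃ (by simp [i₃, i₂, i₁, h1]) (by rw [h9₃]; exact h9)) ?_
  rintro st₄ ⟨w₄, i₄, a₄, b₄⟩
  rw [h9₃] at a₄ b₄ i₄
  have hnew : ∀ S, st₃.wd (newReg S) = st₂.wd (newReg S) := by
    intro S
    refine a₃ _ ?_ (snd_ne_of_mem_acceptRegs ?_) <;> revert S <;> decide
  refine ⟨?_, ?_, ?_, ?_, ?_, ?_⟩
  · rw [i₄, i₃, i₂, i₁]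
    simp [operandTargetRegs, operandTargets, acceptRegs, add_assoc]
  · intro S
    rw [w₄, a₃ _ ?_ (snd_ne_of_mem_acceptRegs ?_), a₂ _ ?_ (snd_ne_of_mem_operandTargetRegs ?_),
      (a₁ S).2.2.1] <;> revert S <;> decide
  · rw [w₄, a₃ _ ?_ (snd_ne_of_mem_acceptRegs ?_), a₂ _ ?_ (snd_ne_of_mem_operandTargetRegs ?_),
      c₁] <;> decide
  · intro S b
    rw [a₄, hnew, b₂ _ (by fin_cases S <;> decide), (a₁ S).2.2.2, hc₁, h7₁]
    simp only [BitVec.ofNat_eq_ofNat, BitVec.getLsbD_zero, Bool.false_eq_true, false_or]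
    have hop : ∀ o, st₁.wd (operandReg o) = operandWord st o := by
      rintro (_ | ⟨_ | _, S⟩)
      · exact c₁
      · exact (a₁ S).1
      · exact (a₁ S).2.1
    have hinj : ∀ S S', newReg S = newReg S' → S = S' := by decide
    constructor
    · rintro ⟨i, a, h, hm, hb⟩
      simp only [operandTargetRegs, List.getElem?_map, Option.map_eq_some_iff, Prod.mk.injEq] at h
      obtain ⟨⟨o, S'⟩, h, rfl, hS⟩ := h
      obtain rfl := hinj _ _ hS
      exact ⟨i, o, h, hm, by rwa [← hop]⟩
    · rintro ⟨i, o, h, hm, hb⟩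
      exact ⟨i, operandReg o, by simp [operandTargetRegs, h], hm, by rwa [hop]⟩
  · intro b
    rw [w₄, b₃ _ (by decide), a₂ 12 (by decide) (snd_ne_of_mem_operandTargetRegs (by decide)), b₁, hc₂, h7₂]
    refine or_congr Iff.rfl ?_
    constructor
    · rintro ⟨i, a, h, hm, hb⟩
      simp only [acceptRegs, List.getElem?_map, Option.map_eq_some_iff, Prod.mk.injEq,
        and_true] at h
      obtain ⟨S, h, rfl⟩ := h
      have hi : i = S := by
        rcases i with _ | _ | _ | i <;> simp at h <;> simp [← h]
      subst hi
      exact ⟨S, hm, by rw [a₄, hnew]; exact hb⟩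
    · rintro ⟨S, hm, hb⟩
      rw [a₄, hnew] at hb
      exact ⟨S, newReg S, by fin_cases S <;> rfl, hm, hb⟩
  · intro x hx
    rw [b₄ x hx, hc₃]

end Program

/-! ## The simulation -/

section Simulation

open RamInstr

/-- The code before the loop: `p` is set to the block of masks of the pair of the last symbol and
the current symbol. -/
def preludeCode : List (RamInstr 16) :=
  [iadd 7 7 0, imul 7 7 3, iadd 7 7 4, iconst 8 0, iconst 9 0, wconst 12 0,
    wconst (prevReg 0) 0, wconst (prevReg 1) 0, wconst (prevReg 2) 0]

/-- The loop that updates the vectors. -/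
def updateLoop : RamProg 16 :=
  .whileLt 8 4 (.straight (load (oldReg 0) 8) bodyCode.tail)

/-- The program that simulates the automaton on one symbol. -/
def simulationProg : RamProg 16 :=
  .seq (.straight (imul 7 1 2) preludeCode) <| .seq updateLoop <|
    .seq (.ifNonzero 12 (.instr (iconst 10 1)) (.instr (iconst 10 0)))
      (.straight (iconst 1 0) [iadd 1 1 0])

theorem exists_getElem?_operandTargets (o : Option (Bool × Fin 3)) (S : Fin 3) :
    ∃ i < 21, operandTargets[i]? = some (o, S) := by
  have h : (o, S) ∈ operandTargets := by
    refine List.pair_mem_product.2 ⟨?_, by fin_cases S <;> simp⟩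
    rcases o with _ | ⟨_ | _, S⟩ <;> fin_cases S <;> simp
  obtain ⟨i, hi⟩ := List.mem_iff_getElem?.1 h
  refine ⟨i, ?_, hi⟩
  by_contra hc
  rw [List.getElem?_eq_none (by simpa [operandTargets] using hc)] at hi
  cases hi

theorem lt_of_getElem?_operandTargets {i : ℕ} {e : Option (Bool × Fin 3) × Fin 3}
    (h : operandTargets[i]? = some e) : i < 21 := by
  by_contra hc
  rw [List.getElem?_eq_none (by simpa [operandTargets] using hc)] at h
  cases h

theorem BitVec.ne_zero_iff_exists_getLsbD {w : ℕ} (x : BitVec w) :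
    x ≠ 0 ↔ ∃ b < w, x.getLsbD b = true := by
  constructor
  · intro h
    by_contra! hc
    exact h (BitVec.eq_of_getLsbD_eq fun b hb => by simpa using hc b hb)
  · rintro ⟨b, -, h⟩ rfl
    simp at h

variable {w s : ℕ}

/-- The invariant of `updateLoop` after `t` rounds. The vectors change from `O` to `N`. -/
structure LoopInv (K : ℕ) (O N A : Fin 3 → ℕ → Prop) (st₀ : RamState w s 16) (t : ℕ)
    (st : RamState w s 16) : Prop where
  idx_eq : ∀ r, r ≠ 7 → r ≠ 8 → r ≠ 9 → st.idx r = st₀.idx r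
  idx_seven : st.idx 7 = st₀.idx 7 + 24 * t
  idx_eight : st.idx 8 = 3 * t
  idx_nine : st.idx 9 = 3 * t
  ones : st.wd 14 = BitVec.allOnes w
  prev : ∀ S, ∀ b < w, (st.wd (prevReg S)).getLsbD b = true ↔ ∃ t₀, t = t₀ + 1 ∧ O S (t₀ * w + b)
  lanes : ∀ (S : Fin 3), ∀ u < K, ∀ b < w, (st.cell (3 * u + S)).getLsbD b = true ↔
    if u < t then N S (u * w + b) else O S (u * w + b)
  masks : ∀ x, 3 * K ≤ x → st.cell x = st₀.cell x
  acc : (∃ b < w, (st.wd 12).getLsbD b = true) ↔ ∃ S, ∃ j < t * w, N S j ∧ A S j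

/-- The vectors are overwritten in place. The old word `t` is still needed in round `t + 1`, for the
bit carried by the shift; this is why it survives in `prevReg`. -/
theorem LoopInv.step {K : ℕ} {O N A : Fin 3 → ℕ → Prop}
    {M : Fin 3 → ℕ → Option (Bool × Fin 3) → Prop} {st₀ : RamState w s 16}
    (hw : 0 < w) (hN : ∀ S j, N S j ↔ ∃ o, M S j o ∧ operandBit O j o)
    (h5 : st₀.idx 5 = 1) (h6 : st₀.idx 6 = w - 1) (h7 : 3 * K ≤ st₀.idx 7)
    (hs : st₀.idx 7 + 24 * K ≤ s)
    (hM : ∀ u < K, ∀ b < w, ∀ (i : ℕ) o S, operandTargets[i]? = some (o, S) →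
      ((st₀.cell (st₀.idx 7 + 24 * u + i)).getLsbD b = true ↔ M S (u * w + b) o))
    (hA : ∀ u < K, ∀ b < w, ∀ S : Fin 3,
      ((st₀.cell (st₀.idx 7 + 24 * u + 21 + S)).getLsbD b = true ↔ A S (u * w + b)))
    {t : ℕ} (ht : t < K) {st : RamState w s 16} (I : LoopInv K O N A st₀ t st) :
    wp bodyCode (LoopInv K O N A st₀ (t + 1)) st := by
  have e5 : st.idx 5 = 1 := by rw [I.idx_eq _ (by decide) (by decide) (by decide), h5]
  have e6 : st.idx 6 = w - 1 := by rw [I.idx_eq _ (by decide) (by decide) (by decide), h6]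
  have e7 := I.idx_seven
  have e8 := I.idx_eight
  have e9 := I.idx_nine
  refine wp_mono (wp_bodyCode st e5 (by omega) (by omega) (by omega)) ?_
  rintro st' ⟨i', p', o', c', a', m'⟩
  rw [e9] at c' a' m'
  rw [e8] at p'
  rw [e7] at c' a'
  have hold : ∀ (S : Fin 3), ∀ b < w, (st.cell (3 * t + S)).getLsbD b = true ↔
      O S (t * w + b) := by
    intro S b hb
    rw [I.lanes S t ht b hb, if_neg (lt_irrefl _)]
  have hop : ∀ o, ∀ b < w, (operandWord st o).getLsbD b = true ↔ operandBit O (t * w + b) o := by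
    rintro (_ | ⟨_ | _, S⟩) b hb
    · simp [operandWord, operandBit, I.ones, hb]
    · simp only [operandWord, operandBit, e8]
      exact hold S b hb
    · simp only [operandWord, operandBit, e8, e6, BitVec.getLsbD_or, BitVec.getLsbD_shiftLeft,
        BitVec.getLsbD_ushiftRight]
      -- Bit `0` of the shifted operand is the top bit of the preceding old word, and `0` in the
      -- first round.
      rcases b with _ | b
      · simp only [add_zero]
        simp only [zero_lt_one, decide_true, Bool.not_true, Bool.and_false, Bool.false_and,
          Bool.false_or]
        rw [I.prev S _ (by omega)]
        constructor
        · rintro ⟨t₀, rfl, h⟩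
          refine ⟨_, ?_, h⟩
          rw [Nat.succ_mul]
          omega
        · rintro ⟨j₀, hj, h⟩
          rcases t with _ | t₀
          · omega
          · refine ⟨t₀, rfl, ?_⟩
            rw [Nat.succ_mul] at hj
            rwa [show t₀ * w + (w - 1) = j₀ by omega]
      -- Above bit `0` the carried word contributes nothing, since its shift by `w - 1` leaves one
      -- bit.
      · rw [BitVec.getLsbD_of_ge _ _ (by omega : w ≤ w - 1 + (b + 1))]
        simp only [hb, decide_true, Bool.true_and, Nat.not_lt.2 (Nat.le_add_left 1 b),
          decide_false, Bool.not_false, Bool.or_false, Nat.add_sub_cancel]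
        rw [hold S b (by omega)]
        constructor
        · exact fun h => ⟨_, rfl, h⟩
        · rintro ⟨j₀, hj, h⟩
          rwa [show t * w + b = j₀ by omega]
  have hnew : ∀ (S : Fin 3), ∀ b < w, (st'.cell (3 * t + S)).getLsbD b = true ↔
      N S (t * w + b) := by
    intro S b hb
    rw [c', hN]
    constructor
    · rintro ⟨i, o, h, hm, ho⟩
      rw [I.masks _ (by omega)] at hm
      exact ⟨o, (hM t ht b hb i o S h).1 hm, (hop o b hb).1 ho⟩
    · rintro ⟨o, hm, ho⟩
      obtain ⟨i, hi, h⟩ := exists_getElem?_operandTargets o S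
      refine ⟨i, o, h, ?_, (hop o b hb).2 ho⟩
      rw [I.masks _ (by omega)]
      exact (hM t ht b hb i o S h).2 hm
  refine ⟨?_, ?_, ?_, ?_, ?_, ?_, ?_, ?_, ?_⟩
  · intro r h7 h8 h9
    rw [i']
    simp [h7, h8, h9, I.idx_eq r h7 h8 h9]
  · simp [i', e7]
    ring
  · simp [i', e8]
    ring
  · simp [i', e9]
    ring
  · rw [o', I.ones]
  · intro S b hb
    rw [p', hold S b hb]
    constructor
    · exact fun h => ⟨t, rfl, h⟩
    · rintro ⟨t₀, h, h'⟩
      obtain rfl : t = t₀ := by omega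
      exact h'
  · intro S u hu b hb
    rcases eq_or_ne u t with rfl | hut
    · rw [hnew S b hb, if_pos (Nat.lt_succ_self _)]
    · rw [m' _ (fun S' => by omega), I.lanes S u hu b hb]
      have : u < t ↔ u < t + 1 := by omega
      simp only [this]
  · intro x hx
    rw [m' _ (fun S' => by omega), I.masks x hx]
  · have hsplit : (∃ b < w, (st'.wd 12).getLsbD b = true) ↔
        (∃ b < w, (st.wd 12).getLsbD b = true) ∨
          ∃ S, ∃ b < w, N S (t * w + b) ∧ A S (t * w + b) := by
      constructor
      · rintro ⟨b, hb, h⟩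
        rcases (a' b).1 h with h | ⟨S, hm, h⟩
        · exact Or.inl ⟨b, hb, h⟩
        · rw [I.masks _ (by omega)] at hm
          exact Or.inr ⟨S, b, hb, (hnew S b hb).1 h, (hA t ht b hb S).1 hm⟩
      · rintro (⟨b, hb, h⟩ | ⟨S, b, hb, h, hm⟩)
        · exact ⟨b, hb, (a' b).2 (Or.inl h)⟩
        · refine ⟨b, hb, (a' b).2 (Or.inr ⟨S, ?_, (hnew S b hb).2 h⟩)⟩
          rw [I.masks _ (by omega)]
          exact (hA t ht b hb S).2 hm
    rw [hsplit, I.acc]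
    constructor
    · rintro (⟨S, j, hj, h⟩ | ⟨S, b, hb, h⟩)
      · exact ⟨S, j, hj.trans_le (Nat.mul_le_mul_right _ (Nat.le_succ t)), h⟩
      · exact ⟨S, t * w + b, by rw [Nat.succ_mul]; omega, h⟩
    · rintro ⟨S, j, hj, h⟩
      by_cases hjt : j < t * w
      · exact Or.inl ⟨S, j, hjt, h⟩
      · rw [Nat.succ_mul] at hj
        refine Or.inr ⟨S, j - t * w, by omega, ?_⟩
        rwa [show t * w + (j - t * w) = j by omega]

variable {σ : ℕ}

/-- The masks, in the order in which they lie in a block. -/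
def blockMask (both : Bool) (P : List (Fin σ)) (a c i j : ℕ) : Prop :=
  if i < 21 then ∃ o S, operandTargets[i]? = some (o, S) ∧ TransMask both P a c S j o
  else ∃ S : Fin 3, i = 21 + S ∧ ∃ p, FactorStep both P S j c p P.length

/-- The configuration represents the set of states reached on `T`. -/
structure Represents (both : Bool) (P : List (Fin σ)) (K : ℕ) (T : List (Fin σ))
    (st : RamState w s 16) : Prop where
  idx_two : st.idx 2 = σ
  idx_three : st.idx 3 = 24 * K
  idx_four : st.idx 4 = 3 * K
  idx_five : st.idx 5 = 1
  idx_six : st.idx 6 = w - 1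
  ones : st.wd 14 = BitVec.allOnes w
  last_lt : st.idx 1 < σ
  last_eq : ∀ x, T.getLast? = some x → (x : ℕ) = st.idx 1
  lanes : ∀ (S : Fin 3), ∀ u < K, ∀ b < w, (st.cell (3 * u + S)).getLsbD b = true ↔
    LaneBit both P T S (u * w + b)
  masks : ∀ a < σ, ∀ c < σ, ∀ u < K, ∀ i < 24, ∀ b < w,
    (st.cell (3 * K + ((a * σ + c) * K + u) * 24 + i)).getLsbD b = true ↔
      blockMask both P a c i (u * w + b)
  out : st.idx 10 = 1 ↔ T ∈ (swapNFA both P).accepts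

theorem mixed_radix_lt {a b m n : ℕ} (ha : a < m) (hb : b < n) : a * n + b < m * n :=
  calc a * n + b < (a + 1) * n := by rw [Nat.succ_mul]; omega
    _ ≤ m * n := Nat.mul_le_mul_right _ ha

/-- The time is made up of 10 instructions before the loop, `K` rounds of 123 instructions and a
test, the failing test, and 4 steps for the output and the last symbol. -/
theorem Represents.step {both : Bool} {P : List (Fin σ)} {K : ℕ} {T : List (Fin σ)}
    {st : RamState w s 16} (hP : P ≠ []) (hw : 0 < w) (hK : collectionSize P ≤ K * w)
    (hK0 : 0 < K) (hs : 3 * K + σ * σ * K * 24 = s) (I : Represents both P K T st) (c : Fin σ)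
    (h0 : st.idx 0 = c) :
    ∃ st', RamRun simulationProg st (124 * K + 15) st' ∧ Represents both P K (T ++ [c]) st' := by
  set a := st.idx 1 with ha
  have hac : a * σ + c < σ * σ := mixed_radix_lt I.last_lt c.2
  have hσ : 0 < σ := c.pos
  -- The block of `(a, c)` starts `(a * σ + c) * 24K` cells after the vectors. That it ends within
  -- memory also keeps the intermediate results of the address computation in range.
  have hacK : (a * σ + c) * (24 * K) + 24 * K ≤ σ * σ * K * 24 :=
    calc (a * σ + c) * (24 * K) + 24 * K = (a * σ + c + 1) * (24 * K) := by ring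
      _ ≤ σ * σ * (24 * K) := Nat.mul_le_mul_right _ hac
      _ = _ := by ring
  have hle : a * σ + c ≤ (a * σ + c) * (24 * K) := Nat.le_mul_of_pos_right _ (by omega)
  have hmax : ∀ v, v ≤ s → v ≤ max s w := fun v => le_max_of_le_left
  have hpre : wp (imul 7 1 2 :: preludeCode) (fun st' =>
      st'.mem = st.mem ∧ st'.idx 7 = (a * σ + c) * (24 * K) + 3 * K ∧ st'.idx 8 = 0 ∧
      st'.idx 9 = 0 ∧ (∀ r, r ≠ 7 → r ≠ 8 → r ≠ 9 → st'.idx r = st.idx r) ∧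
      (∀ S, st'.wd (prevReg S) = 0) ∧ st'.wd 12 = 0 ∧ st'.wd 14 = st.wd 14) st := by
    simp only [preludeCode, wp_imul, wp_iadd, wp_iconst, wp_wconst, wp_nil]
    simp [← ha, I.idx_two, I.idx_three, I.idx_four, h0]
    refine ⟨Or.inl (by omega), Or.inl (by omega), Or.inl (by omega), Or.inl (by omega), ?_, ?_,
      ?_, ?_⟩
    · intro r h7 h8 h9
      simp [h7, h8, h9]
    · intro S
      fin_cases S <;> simp [prevReg]
    · simp [prevReg]
    · simp [prevReg]
  obtain ⟨st₁, r₁, m₁, e7, e8, e9, ei, ep, e12, e14⟩ := exists_ramRun_straight hpre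
  have hc₁ : st₁.cell = st.cell := by funext x; simp [RamState.cell, m₁]
  have hfix : ∀ r, r ≠ 7 → r ≠ 8 → r ≠ 9 → st₁.idx r = st.idx r := ei
  have haddr : ∀ u i, st₁.idx 7 + 24 * u + i = 3 * K + ((a * σ + c) * K + u) * 24 + i := by
    intro u i
    rw [e7]
    ring
  set A : Fin 3 → ℕ → Prop := fun S j => ∃ p, FactorStep both P S j c p P.length
  have hstep := fun t (ht : t < K) st (J : LoopInv K (LaneBit both P T)
      (LaneBit both P (T ++ [c])) A st₁ t st) =>
    LoopInv.step (M := fun S j o => TransMask both P a c S j o) hw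
      (fun S j => laneBit_append_singleton hP I.last_eq c S j)
      (by rw [hfix _ (by decide) (by decide) (by decide), I.idx_five])
      (by rw [hfix _ (by decide) (by decide) (by decide), I.idx_six])
      (by omega) (by omega)
      (by
        intro u hu b hb i o S h
        have hi := lt_of_getElem?_operandTargets h
        rw [hc₁, haddr, I.masks a I.last_lt c c.2 u hu i (by omega) b hb, blockMask, if_pos hi, h]
        simp)
      (by
        intro u hu b hb S
        rw [hc₁, add_assoc, haddr, I.masks a I.last_lt c c.2 u hu _ (by omega) b hb, blockMask,
          if_neg (by omega)]
        constructor
        · rintro ⟨S', hS, h⟩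
          obtain rfl : S = S' := Fin.ext (by omega)
          exact h
        · exact fun h => ⟨S, rfl, h⟩) ht J
  have h4 : ∀ t st, LoopInv K (LaneBit both P T) (LaneBit both P (T ++ [c])) A st₁ t st →
      st.idx 8 = 3 * t ∧ st.idx 4 = 3 * K := by
    intro t st J
    rw [J.idx_eight, J.idx_eq _ (by decide) (by decide) (by decide),
      hfix _ (by decide) (by decide) (by decide), I.idx_four]
    exact ⟨rfl, rfl⟩
  -- One round has `3·7` instructions to fetch, `(21 + 3)·4` for the masks and `3·2` to store, in
  -- all 123.
  obtain ⟨st₂, r₂, J⟩ := exists_ramRun_whileLt (a := 8) (b := 4)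
    (p := .straight (load (oldReg 0) 8) bodyCode.tail)
    (LoopInv K (LaneBit both P T) (LaneBit both P (T ++ [c])) A st₁) K 123
    (fun t ht st J => by have := h4 t st J; omega)
    (fun st J => by have := h4 K st J; omega)
    (fun t ht st J => exists_ramRun_straight (hstep t ht st J)) st₁
    { idx_eq := fun _ _ _ _ => rfl
      idx_seven := by simp
      idx_eight := by simp [e8]
      idx_nine := by simp [e9]
      ones := by rw [e14, I.ones]
      prev := by intro S b hb; simp [ep]
      lanes := by intro S u hu b hb; rw [hc₁, I.lanes S u hu b hb]; simp
      masks := fun _ _ => rfl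
      acc := by simp [e12] }
  -- Only bits below `K * w` have been collected, but factor indices of transitions are below `k ≤ K
  -- * w`, so none is missed.
  have hacc : st₂.wd 12 ≠ 0 ↔ T ++ [c] ∈ (swapNFA both P).accepts := by
    rw [BitVec.ne_zero_iff_exists_getLsbD, J.acc, mem_accepts_iff_length_mem_reached,
      mem_reached_iff_laneBit hP]
    constructor
    · rintro ⟨S, j, -, h, p, hp⟩
      exact Or.inr ⟨c, S, j, p, by simp, hp, h⟩
    · rintro (h | ⟨c', S, j, p, e, hp, h⟩)
      · exact absurd (List.length_eq_zero_iff.1 h) hP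
      · obtain rfl : c = c' := by simpa using e
        exact ⟨S, j, hp.lt_collectionSize.trans_le hK, h, p, hp⟩
  have h1s : 1 ≤ max s w := hmax _ (by omega)
  have hend : ∃ st₃, RamRun (.seq (.ifNonzero 12 (.instr (iconst 10 1)) (.instr (iconst 10 0)))
      (.straight (iconst 1 0) [iadd 1 1 0])) st₂ 4 st₃ ∧ st₃.wd = st₂.wd ∧ st₃.mem = st₂.mem ∧
      (st₃.idx 10 = 1 ↔ T ++ [c] ∈ (swapNFA both P).accepts) ∧ st₃.idx 1 = c ∧
      ∀ r, r ≠ 1 → r ≠ 10 → st₃.idx r = st₂.idx r := by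
    have h0₂ : st₂.idx 0 = c := by
      rw [J.idx_eq _ (by decide) (by decide) (by decide),
        hfix _ (by decide) (by decide) (by decide), h0]
    have hc : (c : ℕ) ≤ max s w := hmax _ (by omega)
    have key : ∀ v ≤ 1, wp [iconst 1 0, iadd 1 1 0] (fun st₃ => st₃.wd = st₂.wd ∧
        st₃.mem = st₂.mem ∧ st₃.idx 10 = v ∧ st₃.idx 1 = c ∧
        ∀ r, r ≠ 1 → r ≠ 10 → st₃.idx r = st₂.idx r)
        ({ st₂ with idx := Function.update st₂.idx 10 v } : RamState w s 16) := by
      intro v hv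
      simp only [wp_iconst, wp_iadd, wp_nil]
      simp [Function.update_apply, h0₂, le_max_iff.1 hc]
      intro r h1 h10
      simp [h1, h10]
    have hset : ∀ v ≤ 1, (iconst 10 v : RamInstr 16).exec st₂ =
        some { st₂ with idx := Function.update st₂.idx 10 v } := by
      intro v hv
      simp only [exec, RamState.setIdx]
      rw [if_pos (hv.trans h1s)]
    by_cases hz : st₂.wd 12 = 0
    · obtain ⟨st₃, r₃, hw₃, hm₃, ho₃, hl₃, hr₃⟩ := exists_ramRun_straight (key 0 (by omega))
      refine ⟨st₃, .seq (.ifNonzero_false hz (.instr (hset 0 (by omega)))) r₃, hw₃, hm₃, ?_, hl₃,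
        hr₃⟩
      rw [← hacc, ho₃]
      simp [hz]
    · obtain ⟨st₃, r₃, hw₃, hm₃, ho₃, hl₃, hr₃⟩ := exists_ramRun_straight (key 1 le_rfl)
      refine ⟨st₃, .seq (.ifNonzero_true hz (.instr (hset 1 le_rfl))) r₃, hw₃, hm₃, ?_, hl₃, hr₃⟩
      rw [← hacc, ho₃]
      exact iff_of_true rfl hz
  obtain ⟨st₃, r₃, hw₃, hm₃, ho₃, hl₃, hr₃⟩ := hend
  have hc₃ : st₃.cell = st₂.cell := by funext x; simp [RamState.cell, hm₃]
  have hidx : ∀ r, r ≠ 1 → r ≠ 10 → r ≠ 7 → r ≠ 8 → r ≠ 9 → st₃.idx r = st.idx r := by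
    intro r h1 h2 h3 h4 h5
    rw [hr₃ r h1 h2, J.idx_eq r h3 h4 h5, hfix r h3 h4 h5]
  refine ⟨st₃, ?_, ?_⟩
  · have := RamRun.seq r₁ (RamRun.seq r₂ r₃)
    rwa [show preludeCode.length + 1 + (K * (123 + 1) + 1 + 4) = 124 * K + 15 by
      simp [preludeCode]; ring] at this
  · exact
    { idx_two := by rw [hidx _ (by decide) (by decide) (by decide) (by decide) (by decide), I.idx_two]
      idx_three := by
        rw [hidx _ (by decide) (by decide) (by decide) (by decide) (by decide), I.idx_three]
      idx_four := by
        rw [hidx _ (by decide) (by decide) (by decide) (by decide) (by decide), I.idx_four]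
      idx_five := by
        rw [hidx _ (by decide) (by decide) (by decide) (by decide) (by decide), I.idx_five]
      idx_six := by rw [hidx _ (by decide) (by decide) (by decide) (by decide) (by decide), I.idx_six]
      ones := by rw [hw₃, J.ones]
      last_lt := hl₃ ▸ c.2
      last_eq := by
        intro x hx
        obtain rfl : c = x := by simpa using hx
        exact hl₃.symm
      lanes := by
        intro S u hu b hb
        rw [hc₃, J.lanes S u hu b hb, if_pos hu]
      masks := by
        intro a ha c hc u hu i hi b hb
        rw [hc₃, J.masks _ (by omega), hc₁, I.masks a ha c hc u hu i hi b hb]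
      out := ho₃ }

end Simulation

/-! ### Decoding the states, the initial content and the final bounds. -/

section Encoding

open Classical in
/-- The pairs of a symbol and a bit position for the state `q_q`. -/
noncomputable def laneProbe {σ : ℕ} (both : Bool) (P : List (Fin σ)) (s w q : ℕ) :
    Finset (Fin σ × Fin s × Fin w) :=
  Finset.univ.filter fun z => ∃ (S : Fin 3) (j p : ℕ), FactorStep both P S j z.1 p q ∧
    (z.2.1 : ℕ) = 3 * (j / w) + S ∧ (z.2.2 : ℕ) = j % w

theorem mem_laneProbe {σ : ℕ} {both : Bool} {P : List (Fin σ)} {s w q : ℕ}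
    {z : Fin σ × Fin s × Fin w} : z ∈ laneProbe both P s w q ↔
      ∃ (S : Fin 3) (j p : ℕ), FactorStep both P S j z.1 p q ∧
        (z.2.1 : ℕ) = 3 * (j / w) + S ∧ (z.2.2 : ℕ) = j % w := by
  simp [laneProbe]

/-- The words of the three lanes are interleaved, so the address modulo 3 reveals the lane; within a
lane the state fixes factor and symbol. -/
theorem card_laneProbe_le {σ : ℕ} (both : Bool) (P : List (Fin σ)) (s w q : ℕ) :
    (laneProbe both P s w q).card ≤ 3 := by
  have : Set.InjOn (fun z : Fin σ × Fin s × Fin w => (z.2.1 : ℕ) % 3)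
      (laneProbe both P s w q) := by
    intro z hz z' hz' h
    obtain ⟨S, j, p, hs, h1, h2⟩ := mem_laneProbe.1 hz
    obtain ⟨S', j', p', hs', h1', h2'⟩ := mem_laneProbe.1 hz'
    simp only at h
    obtain rfl : S = S' := Fin.ext (by omega)
    obtain ⟨rfl, hc⟩ := hs.factor_label_unique hs'
    exact Prod.ext (Fin.ext hc)
      (Prod.ext (Fin.ext (h1.trans h1'.symm)) (Fin.ext (h2.trans h2'.symm)))
  calc _ ≤ (Finset.range 3).card := Finset.card_le_card_of_injOn _
        (fun z _ => Finset.mem_coe.2 (Finset.mem_range.2 (Nat.mod_lt _ (by norm_num)))) this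
    _ = 3 := Finset.card_range 3

theorem Represents.mem_eval_iff {σ w s : ℕ} {both : Bool} {P : List (Fin σ)} {K : ℕ}
    {T : List (Fin σ)} {st : RamState w s 16} (hP : P ≠ []) (hw : 0 < w)
    (hK : collectionSize P ≤ K * w) (hs : 3 * K ≤ s) (I : Represents both P K T st)
    (q : Fin (2 * P.length)) :
    q ∈ (swapNFA both P).eval T ↔
      (q : ℕ) = 0 ∨ BitEncodes (fun q => laneProbe both P s w q) st.mem T.getLast? q := by
  rw [← val_mem_reached, mem_reached_iff_laneBit hP]
  refine or_congr Iff.rfl ?_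
  have hbit : ∀ (S : Fin 3) (j : ℕ) (x : Fin s) (y : Fin w), j < collectionSize P →
      (x : ℕ) = 3 * (j / w) + S → (y : ℕ) = j % w →
      ((st.mem x).getLsbD y = true ↔ LaneBit both P T S j) := by
    intro S j x y hj hx hy
    have hu : j / w < K := Nat.div_lt_of_lt_mul (by rw [mul_comm]; omega)
    have := I.lanes S (j / w) hu (j % w) (Nat.mod_lt _ hw)
    rwa [Nat.div_add_mod', ← hx, ← hy, RamState.cell, dif_pos x.2] at this
  constructor
  · rintro ⟨c, S, j, p, hc, h, hb⟩
    have hj := h.lt_collectionSize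
    have hu : j / w < K := Nat.div_lt_of_lt_mul (by rw [mul_comm]; omega)
    refine ⟨(c, ⟨3 * (j / w) + S, by omega⟩, ⟨j % w, Nat.mod_lt _ hw⟩),
      mem_laneProbe.2 ⟨S, j, p, h, rfl, rfl⟩, hc, ?_⟩
    exact (hbit S j _ _ hj rfl rfl).2 hb
  · rintro ⟨⟨c, x, y⟩, hz, hc, hb⟩
    obtain ⟨S, j, p, h, hx, hy⟩ := mem_laneProbe.1 hz
    exact ⟨c, S, j, p, hc, h, (hbit S j x y h.lt_collectionSize hx hy).1 hb⟩

open Classical in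
/-- The initial configuration: the vectors are zero, and the masks follow them. -/
noncomputable def initialState {σ : ℕ} (both : Bool) (P : List (Fin σ)) (K w s : ℕ) :
    RamState w s 16 where
  idx := ![0, 0, σ, 24 * K, 3 * K, 1, w - 1, 0, 0, 0, 0, 0, 0, 0, 0, 0]
  wd := fun _ => BitVec.allOnes w
  mem := fun x =>
    if (x : ℕ) < 3 * K then 0
    else
      let y := (x : ℕ) - 3 * K
      BitVec.ofFnLE fun b => decide
        (blockMask both P (y / 24 / K / σ) (y / 24 / K % σ) (y % 24) (y / 24 % K * w + b))

theorem mul_add_div_mod {a b n : ℕ} (hb : b < n) : (a * n + b) / n = a ∧ (a * n + b) % n = b := by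
  constructor
  · rw [mul_comm, Nat.mul_add_div (by omega), Nat.div_eq_of_lt hb, add_zero]
  · rw [mul_comm, Nat.mul_add_mod, Nat.mod_eq_of_lt hb]

theorem represents_initialState {σ w s : ℕ} {both : Bool} {P : List (Fin σ)} {K : ℕ}
    (hP : P ≠ []) (hσ : 0 < σ) (hs : 3 * K + σ * σ * K * 24 = s) :
    Represents both P K [] (initialState both P K w s) where
  idx_two := rfl
  idx_three := rfl
  idx_four := rfl
  idx_five := rfl
  idx_six := rfl
  ones := rfl
  -- Before the first symbol the register for the last symbol holds `0`; any symbol would do, since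
  -- all vectors are zero.
  last_lt := hσ
  last_eq := by simp
  lanes := by
    intro S u hu b hb
    have h : 3 * u + (S : ℕ) < 3 * K := by omega
    simp [RamState.cell, initialState, h, not_laneBit_nil]
  masks := by
    intro a ha c hc u hu i hi b hb
    have hx := mixed_radix_lt (mixed_radix_lt (mixed_radix_lt ha hc) hu) hi
    obtain ⟨h1, h2⟩ := mul_add_div_mod (a := (a * σ + c) * K + u) hi
    obtain ⟨h3, h4⟩ := mul_add_div_mod (a := a * σ + c) hu
    obtain ⟨h5, h6⟩ := mul_add_div_mod (a := a) hc
    rw [RamState.cell, dif_pos (by omega)]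
    simp only [initialState]
    rw [if_neg (by omega), show 3 * K + ((a * σ + c) * K + u) * 24 + i - 3 * K =
      ((a * σ + c) * K + u) * 24 + i by omega, h1, h2, h3, h4, h5, h6]
    simp [hb]
  out := by
    rw [mem_accepts_iff_length_mem_reached, mem_reached_nil hP]
    have : (initialState both P K w s).idx 10 = 0 := rfl
    simp [this, hP]

theorem Represents.exists_ramReads {σ w s : ℕ} {both : Bool} {P : List (Fin σ)} {K : ℕ}
    (hP : P ≠ []) (hw : 0 < w) (hK : collectionSize P ≤ K * w) (hK0 : 0 < K)
    (hs : 3 * K + σ * σ * K * 24 = s) (T T₀ : List (Fin σ)) (st : RamState w s 16)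
    (I : Represents both P K T₀ st) :
    ∃ st', RamReads simulationProg 0 st T (T.length * (124 * K + 16)) st' ∧
      Represents both P K (T₀ ++ T) st' := by
  induction T generalizing T₀ st with
  | nil => exact ⟨st, by simpa using RamReads.nil st, by simpa using I⟩
  | cons c T ih =>
    have hc : (c : ℕ) ≤ max s w := by
      have h1 : σ ≤ σ * σ := Nat.le_mul_self σ
      have h2 : σ * σ ≤ σ * σ * K := Nat.le_mul_of_pos_right _ hK0
      exact le_max_of_le_left (by omega)
    have I₁ : Represents both P K T₀ { st with idx := Function.update st.idx 0 (c : ℕ) } :=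
      { idx_two := I.idx_two
        idx_three := I.idx_three
        idx_four := I.idx_four
        idx_five := I.idx_five
        idx_six := I.idx_six
        ones := I.ones
        last_lt := I.last_lt
        last_eq := I.last_eq
        lanes := I.lanes
        masks := I.masks
        out := I.out }
    obtain ⟨st₂, r₂, I₂⟩ := I₁.step hP hw hK hK0 hs c (by simp)
    obtain ⟨st₃, r₃, I₃⟩ := ih (T₀ ++ [c]) st₂ I₂
    refine ⟨st₃, ?_, by simpa using I₃⟩
    have := RamReads.cons (c := c) (if_pos hc) r₂ r₃
    rwa [show 1 + (124 * K + 15) + T.length * (124 * K + 16) =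
      (c :: T).length * (124 * K + 16) by rw [List.length_cons]; ring] at this

theorem mul_add_le_mul_sq {σ K : ℕ} (hσ : 0 < σ) (hK : 0 < K) :
    3 * K + σ * σ * K * 24 + 2 * 16 ≤ 200 * (σ ^ 2 * K) := by
  have h1 : 1 * K ≤ σ * σ * K := Nat.mul_le_mul_right _ (Nat.mul_pos hσ hσ)
  rw [sq]
  omega

theorem mainTheorem4 :
    -- one program and one constant for all patterns, alphabets and word sizes
    ∃ (R : ℕ) (inp out : Fin R) (prog : RamProg R) (C : ℕ),
      ∀ (σ w : ℕ) (P : List (Fin σ)), 0 < w → P ≠ [] →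
        -- the range of `k`
        (P.length ⌈/⌉ σ ≤ collectionSize P ∧ collectionSize P ≤ P.length) ∧
        ∀ both : Bool,
          -- the encoding of the automaton: the initial content of a machine with `s` cells
          ∃ (s : ℕ) (init : RamState w s R)
            (probe : Fin (2 * P.length) → Finset (Fin σ × Fin s × Fin w)),
            init.Valid ∧
            -- space
            s + 2 * R ≤ C * (σ ^ 2 * (collectionSize P ⌈/⌉ w)) ∧
            (∀ q, (probe q).card ≤ C) ∧
            ∀ T : List (Fin σ), ∃ (t : ℕ) (st : RamState w s R),
              RamReads prog inp init T t st ∧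
              -- time
              t ≤ C * (T.length * (collectionSize P ⌈/⌉ w)) ∧
              -- the configuration reached on `T`
              (∀ q : Fin (2 * P.length), q ∈ (swapNFA both P).eval T ↔
                (q : ℕ) = 0 ∨ BitEncodes probe st.mem T.getLast? q) ∧
              -- acceptance of `T`
              (st.idx out = 1 ↔ T ∈ (swapNFA both P).accepts) := by
  -- The constant 200 is generous: as `K ≥ 1` and `σ ≥ 1`, a symbol costs `124K + 16 ≤ 140K` steps,
  -- and the space is `3K + 24σ²K + 32 ≤ 59σ²K`.
  refine ⟨16, 0, 10, simulationProg, 200, fun σ w P hw hP => ?_⟩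
  have hσ : 0 < σ := by
    obtain ⟨c, l, rfl⟩ := List.exists_cons_of_ne_nil hP
    exact c.pos
  refine ⟨⟨?_, collectionSize_le_length P⟩, fun both => ?_⟩
  · rw [ceilDiv_le_iff_le_mul hσ, mul_comm]
    simpa using length_le_collectionSize_mul_card P
  obtain ⟨K, hKdef⟩ : ∃ K, collectionSize P ⌈/⌉ w = K := ⟨_, rfl⟩
  have hK : collectionSize P ≤ K * w := by
    rw [mul_comm, ← ceilDiv_le_iff_le_mul hw, hKdef]
  have hK0 : 0 < K := by
    have := collectionSize_pos hP
    rcases Nat.eq_zero_or_pos K with h | h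
    · simp [h] at hK
      omega
    · exact h
  rw [hKdef]
  have hσσ : σ * K ≤ σ * σ * K := Nat.mul_le_mul_right _ (Nat.le_mul_self σ)
  have hσK : σ ≤ σ * K := Nat.le_mul_of_pos_right _ hK0
  have hKσ : K ≤ σ * K := Nat.le_mul_of_pos_left _ hσ
  refine ⟨3 * K + σ * σ * K * 24, initialState both P K w _, fun q => laneProbe both P _ w q, ?_,
    mul_add_le_mul_sq hσ hK0, fun q => (card_laneProbe_le both P _ w q).trans (by norm_num),
    fun T => ?_⟩
  -- The value `w - 1` is in range because of `w`, all other initial indices because of the number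
  -- of cells.
  · intro r
    simp only [initialState]
    fin_cases r <;> simp <;> omega
  · obtain ⟨st, hr, I⟩ := Represents.exists_ramReads hP hw hK hK0 rfl T [] _
      (represents_initialState (w := w) (both := both) hP hσ rfl)
    rw [List.nil_append] at I
    refine ⟨_, st, hr, ?_, I.mem_eval_iff hP hw hK (by omega), I.out⟩
    calc T.length * (124 * K + 16) ≤ T.length * (200 * K) := Nat.mul_le_mul_left _ (by omega)
      _ = _ := by ring

end Encoding
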